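/- **Local convergence of the discrete momentum-based constrained saddle dynamics (MCSD).** *Setting.* Let $f:\mathbb R^d\to\mathbb R$ and $c_1,\dots,c_m:\mathbb R^d\to\mathbb R$ be smooth, and let $\mathcal M=\{x: c_1(x)=\dots=c_m(x)=0\}$, where $\nabla c_1(x),\dots,\nabla c_m(x)$ are linearly independent at every $x\in\mathcal M$. Give $\mathcal M$ the metric induced from $\mathbb R^d$, with geodesic distance $d(\cdot,\cdot)$, exponential map $\exp$ and parallel transport. Let $P(x)$ be the orthogonal projector of $\mathbb R^d$ onto $T_x\mathcal M=\{\nabla c_1(x),\dots,\nabla c_m(x)\}^{\perp}$, let $\operatorname{grad} f(x)=P(x)\nabla f(x)$, and let $\operatorname{Hess} f(x)[v]=P(x)\,\partial_v \operatorname{grad} f(x)$ for $v\in T_x\mathcal M$. Let $0\le k\le d-m$, and let $x^*\in\mathcal M$ satisfy $\operatorname{grad} f(x^*)=0$. *Strict-saddle assumption.* There are $\delta>0$ and $L>\mu>0$ such that for every $x\in\mathcal M$ with $d(x,x^*)<\delta$ the eigenvalues of $\operatorname{Hess} f(x)$ satisfy $$-L\le\lambda_1\le\dots\le\lambda_k\le-\mu<0<\mu\le\lambda_{k+1}\le\dots\le\lambda_{d-m}\le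 L .$$ Put $\kappa=L/\mu$, $q=1-\frac1{1+\sqrt\kappa}$ and $$\Delta t=\frac{4}{(\sqrt L+\sqrt\mu)^2},\qquad \gamma=\Big(\frac{\sqrt L-\sqrt\mu}{\sqrt L+\sqrt\mu}\Big)^2 .$$ *Iteration.* A run from $x_0\in\mathcal M$ consists of sequences $x_n$, $r_n$, $v_{i,n}$ with $r_0=0$ such that, for every $n\ge0$, $v_{1,n},\dots,v_{k,n}$ are orthonormal eigenvectors for the $k$ smallest eigenvalues of $\operatorname{Hess} f(x_n)$ and $$\bar r_n=-\Delta t\Big(I-2\sum_{i=1}^k v_{i,n}v_{i,n}^\top\Big)\operatorname{grad} f(x_n)+\gamma r_n,\qquad x_{n+1}=\exp_{x_n}(\bar r_n),\qquad r_{n+1}=P_{x_n\to x_{n+1}}\bar r_n ,$$ where $P_{x_n\to x_{n+1}}$ is parallel transport along the geodesic $t\mapsto\exp_{x_n}(t\bar r_n)$, $0\le t\le1$. *Linearization.* Let $R^*=I-2\sum_{i=1}^k v_i^*{v_i^*}^\top$, where $v_1^*,\dots,v_k^*$ are orthonormal eigenvectors for the $k$ smallest eigenvalues of $H^*=\operatorname{Hess}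 f(x^*)$, and let $$A=\begin{pmatrix} I-\Delta t R^*H^* & \gamma I\\ -\Delta t R^*H^* & \gamma I\end{pmatrix}\quad\text{on } T_{x^*}\mathcal M\oplus T_{x^*}\mathcal M ,\qquad \|(\zeta,\rho)\|=\sqrt{\|\zeta\|^2+\|\rho\|^2} .$$ *Claim.* 1. There is a constant $C_0\ge1$ with $\|A^j\|\le C_0q^j$ for all $j\ge1$. 2. There are $r,r_1,C,r^*>0$ with $r^*\le r$ and the following properties. (a) The coordinates $\zeta=\exp_{x^*}^{-1}(x)$, with $\|\zeta\|<r$, and $\rho=P_{x\to x^*}w$, the parallel transport of $w\in T_x\mathcal M$ along the geodesic $t\mapsto\exp_{x^*}(t\zeta)$ traversed from $x$ to $x^*$, are unique whenever they exist. They exist for all $x\in\mathcal M$ with $d(x,x^*)<r_1$ and all $w\in T_x\mathcal M$. Every $(\zeta,\rho)\in T_{x^*}\mathcal M\oplus T_{x^*}\mathcal M$ with $\|\zeta\|<r$ is the coordinate pair of exactly one $(x,w)$, and this $x\in\mathcal M$ satisfies $d(x,x^*)<\delta$, with $w\in T_x\mathcal M$. (b) From every pair $(x,w)$ with coordinates satisfying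 $\|(\zeta,\rho)\|<r^*$ a step of the iteration exists, and every such step leads to a pair with coordinates $(\zeta',\rho')$ satisfying $\|(\zeta',\rho')-A(\zeta,\rho)\|\le C(\|\zeta\|^2+\|\rho\|^2)$. (c) For every $C_0$ as in 1, every $C_h>2C_0$ and every $x_0=\exp_{x^*}(\zeta_0)$ with $\zeta_0\in T_{x^*}\mathcal M$, $\|\zeta_0\|<r$ and $$\|\zeta_0\|\le\min\Big(\frac{\sqrt\kappa}{(1+\sqrt\kappa)^2\,C\,C_h^2},\ \frac{r^*}{C_h}\Big),$$ a run from $x_0$ exists. Every run from $x_0$ converges to $x^*$, the coordinates $(\zeta_n,\rho_n)$ of $(x_n,r_n)$ exist for all $n$, with $\rho_0=0$, and $$\|\zeta_n\|\le\|(\zeta_n,\rho_n)\|\le C_h\Big(1-\frac1{1+\sqrt\kappa}\Big)^n\|(\zeta_0,\rho_0)\|\qquad(n\ge0).$$ -/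

import Mathlib

open Set Filter Topology MeasureTheory
open scoped ContDiff ENNReal

noncomputable section

namespace MCSD

/-- The ambient Euclidean space `ℝ^d`. -/
abbrev E (d : ℕ) := EuclideanSpace ℝ (Fin d)

variable {d m k : ℕ}

/-- The feasible set `M = {x : c_1(x) = ... = c_m(x) = 0}`. -/
def feasible (c : Fin m → E d → ℝ) : Set (E d) := {x | ∀ i, c i x = 0}

/-- Linear independence constraint qualification: the matrix `A(x) = (∇c_1(x), ..., ∇c_m(x))` has
full column rank at every feasible point. -/
def LICQ (c : Fin m → E d → ℝ) : Prop :=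
  ∀ x ∈ feasible c, LinearIndependent ℝ (fun i => gradient (c i) x)

/-- The tangent space `T_x M`, the orthogonal complement of the span of the `∇c_i(x)`. -/
def tangent (c : Fin m → E d → ℝ) (x : E d) : Submodule ℝ (E d) :=
  (Submodule.span ℝ (Set.range fun i => gradient (c i) x))ᗮ

/-- The orthogonal projector `P(x)` of `ℝ^d` onto `T_x M`. -/
def proj (c : Fin m → E d → ℝ) (x : E d) : E d →L[ℝ] E d := (tangent c x).starProjection

/-- The Riemannian gradient `grad f(x) = P(x) ∇f(x)`. -/
def rgrad (c : Fin m → E d → ℝ) (f : E d → ℝ) (x : E d) : E d := proj c x (gradient f x)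

/-- The Riemannian Hessian `Hess f(x)[v] = P(x) (∂_v grad f(x))`, to be applied to `v ∈ T_x M`. -/
def hess (c : Fin m → E d → ℝ) (f : E d → ℝ) (x : E d) : E d →L[ℝ] E d :=
  (proj c x).comp (fderiv ℝ (rgrad c f) x)

/-- `b` is an orthonormal basis of `T_x M` (which has dimension `d - m`) of eigenvectors of
`Hess f(x)`, with eigenvalues `l` listed in increasing order with multiplicity. -/
structure IsEigenbasis (c : Fin m → E d → ℝ) (f : E d → ℝ) (x : E d)
    (b : Fin (d - m) → E d) (l : Fin (d - m) → ℝ) : Prop where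
  tangent : ∀ i, b i ∈ tangent c x
  orthonormal : Orthonormal ℝ b
  eigen : ∀ i, hess c f x (b i) = l i • b i
  mono : Monotone l

/-- `v_1, ..., v_k` are exact orthonormal eigenvectors for the `k` smallest eigenvalues of
`Hess f(x)`. -/
def IsUnstableFrame (c : Fin m → E d → ℝ) (f : E d → ℝ) (hk : k ≤ d - m) (x : E d)
    (v : Fin k → E d) : Prop :=
  ∃ b l, IsEigenbasis c f x b l ∧ ∀ i, v i = b (Fin.castLE hk i)

/-- The Householder operator `I - 2 ∑ v_i v_iᵀ`. -/
def householder (v : Fin k → E d) : E d →L[ℝ] E d :=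
  ContinuousLinearMap.id ℝ (E d) - (2 : ℝ) • ∑ i, (innerSL ℝ (v i)).smulRight (v i)

/-- The geodesic distance on `M`: the infimum of the lengths of `C¹` curves in `M` from `x` to `y`
(equal to `∞` when there is none). -/
def geodesicDist (c : Fin m → E d → ℝ) (x y : E d) : ℝ≥0∞ :=
  ⨅ (g : ℝ → E d) (_ : ContDiffOn ℝ 1 g (Icc 0 1) ∧ (∀ t ∈ Icc (0 : ℝ) 1, g t ∈ feasible c) ∧
      g 0 = x ∧ g 1 = y), ∫⁻ t in Icc (0 : ℝ) 1, ‖derivWithin g (Icc 0 1) t‖ₑ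

/-- The covariant derivative `D/dt V = P(g(t)) V'(t)` of `V` along the curve `g : [0,1] → M`. -/
def covDeriv (c : Fin m → E d → ℝ) (g V : ℝ → E d) (t : ℝ) : E d :=
  proj c (g t) (derivWithin V (Icc 0 1) t)

/-- `g : [0,1] → M` is a geodesic: its velocity has zero covariant derivative. -/
structure IsGeodesic (c : Fin m → E d → ℝ) (g : ℝ → E d) : Prop where
  smooth : ContDiffOn ℝ 2 g (Icc 0 1)
  feasible : ∀ t ∈ Icc (0 : ℝ) 1, g t ∈ feasible c
  geodesic : ∀ t ∈ Icc (0 : ℝ) 1, covDeriv c g (derivWithin g (Icc 0 1)) t = 0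

/-- `V` is a parallel tangent vector field along `g : [0,1] → M`. -/
structure IsParallel (c : Fin m → E d → ℝ) (g V : ℝ → E d) : Prop where
  smooth : ContDiffOn ℝ 1 V (Icc 0 1)
  tangent : ∀ t ∈ Icc (0 : ℝ) 1, V t ∈ tangent c (g t)
  parallel : ∀ t ∈ Icc (0 : ℝ) 1, covDeriv c g V t = 0

/-- `y = exp_x(u)`, and `z ∈ T_y M` is the parallel transport of `w ∈ T_x M` from `x` to `y` along
the geodesic `t ↦ exp_x(t u)`, `0 ≤ t ≤ 1`. -/
def ExpTransport (c : Fin m → E d → ℝ) (x u w y z : E d) : Prop :=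
  ∃ g V : ℝ → E d, IsGeodesic c g ∧ g 0 = x ∧ derivWithin g (Icc 0 1) 0 = u ∧ g 1 = y ∧
    IsParallel c g V ∧ V 0 = w ∧ V 1 = z

/-- One step `(x, w) ↦ (x', w')` of the discrete momentum-based constrained saddle dynamics with
step size `dt` and momentum parameter `γ`, retraction by the exponential map and exact unstable
eigenvectors `v` of `Hess f(x)`: with `u = -dt (I - 2 ∑ v_i v_iᵀ) grad f(x) + γ w`,
the new point is `x' = exp_x(u)` and the new momentum `w'` is the parallel transport of `u`. -/
def IsStep (c : Fin m → E d → ℝ) (f : E d → ℝ) (hk : k ≤ d - m) (dt γ : ℝ)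
    (x w : E d) (v : Fin k → E d) (x' w' : E d) : Prop :=
  IsUnstableFrame c f hk x v ∧
    ExpTransport c x (-(dt • householder v (rgrad c f x)) + γ • w)
      (-(dt • householder v (rgrad c f x)) + γ • w) x' w'

/-- The sequences `x_n`, `w_n` (momenta, called `r_n` in formulas) and `v_{i,n}` are generated by
the discrete momentum-based constrained saddle dynamics started at `x0` with zero momentum. -/
structure IsRun (c : Fin m → E d → ℝ) (f : E d → ℝ) (hk : k ≤ d - m) (dt γ : ℝ) (x0 : E d)
    (x w : ℕ → E d) (v : ℕ → Fin k → E d) : Prop where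
  start : x 0 = x0
  momentum : w 0 = 0
  step : ∀ n, IsStep c f hk dt γ (x n) (w n) (v n) (x (n + 1)) (w (n + 1))

/-- `(ζ, ρ) ∈ T_{xs} M × T_{xs} M` are the local coordinates at `xs` of `(x, w)`, where `w ∈ T_x M`:
`ζ = exp_{xs}⁻¹(x)`, with `exp_{xs}` restricted to the ball of radius `r`, and `ρ` is the parallel
transport of `w` from `x` to `xs` along the geodesic `t ↦ exp_{xs}(t ζ)`. -/
def IsCoord (c : Fin m → E d → ℝ) (xs : E d) (r : ℝ) (x w : E d) (p : E d × E d) : Prop :=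
  p.1 ∈ tangent c xs ∧ p.2 ∈ tangent c xs ∧ ‖p.1‖ < r ∧ ExpTransport c xs p.1 p.2 x w

/-- The Euclidean norm `√(‖ζ‖² + ‖ρ‖²)` of a pair. -/
def pairNorm (p : E d × E d) : ℝ := √(‖p.1‖ ^ 2 + ‖p.2‖ ^ 2)

/-- The block operator `(ζ, ρ) ↦ ((I - dt K) ζ + γ ρ, -dt K ζ + γ ρ)`. -/
def blockOp (dt γ : ℝ) (K : E d →L[ℝ] E d) : (E d × E d) →L[ℝ] (E d × E d) :=
  ((ContinuousLinearMap.id ℝ (E d) - dt • K).comp (ContinuousLinearMap.fst ℝ (E d) (E d)) +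
      γ • ContinuousLinearMap.snd ℝ (E d) (E d)).prod
    (-(dt • K).comp (ContinuousLinearMap.fst ℝ (E d) (E d)) +
      γ • ContinuousLinearMap.snd ℝ (E d) (E d))

/-- The linearised iteration `A` at `xs`, that is `blockOp` with `K = R* H*`, where
`R* = I - 2 ∑ v_i v_iᵀ` and `H* = Hess f(xs)`. -/
def linIter (c : Fin m → E d → ℝ) (f : E d → ℝ) (dt γ : ℝ) (xs : E d) (vs : Fin k → E d) :
    (E d × E d) →L[ℝ] (E d × E d) :=
  blockOp dt γ ((householder vs).comp (hess c f xs))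

/-- Strict saddle assumption: at every point of `M` at geodesic distance less than `δ` from `xs`,
the eigenvalues of the Riemannian Hessian satisfy
`-L ≤ l_1 ≤ ... ≤ l_k ≤ -μ < 0 < μ ≤ l_{k+1} ≤ ... ≤ l_{d-m} ≤ L`. -/
def StrictSaddle (c : Fin m → E d → ℝ) (f : E d → ℝ) (k : ℕ) (xs : E d) (δ L μ : ℝ) : Prop :=
  ∀ x ∈ feasible c, geodesicDist c x xs < ENNReal.ofReal δ →
    ∃ b l, IsEigenbasis c f x b l ∧
      ∀ i : Fin (d - m), ((i : ℕ) < k → -L ≤ l i ∧ l i ≤ -μ) ∧ (k ≤ (i : ℕ) → μ ≤ l i ∧ l i ≤ L)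

/-- `Δt* = 4 / (√L + √μ)²`. -/
def stepSize (L μ : ℝ) : ℝ := 4 / (√L + √μ) ^ 2

/-- `γ* = ((√L - √μ) / (√L + √μ))²`. -/
def momentumParam (L μ : ℝ) : ℝ := ((√L - √μ) / (√L + √μ)) ^ 2

/-- The rate `1 - 1 / (1 + √κ)`. -/
def rate (κ : ℝ) : ℝ := 1 - 1 / (1 + √κ)

/-- `C0 ≥ 1` bounds the powers of `A` on `T_{xs} M ⊕ T_{xs} M`: `‖A^j‖ ≤ C0 q^j` for `j ≥ 1`. -/
def IsPowerBound (c : Fin m → E d → ℝ) (xs : E d) (A : (E d × E d) →L[ℝ] (E d × E d))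
    (q C0 : ℝ) : Prop :=
  1 ≤ C0 ∧ ∀ j : ℕ, 1 ≤ j → ∀ p : E d × E d, p.1 ∈ tangent c xs → p.2 ∈ tangent c xs →
    pairNorm ((A ^ j) p) ≤ C0 * q ^ j * pairNorm p

/-- Local coordinates at `xs` are well defined: a pair `(x, w)` has at most one pair of coordinates
of radius `r`; it has one whenever `x ∈ M` is at geodesic distance less than `r1` from `xs` and
`w ∈ T_x M`. Conversely every `(ζ, ρ) ∈ T_{xs} M × T_{xs} M` with `‖ζ‖ < r` is the pair of
coordinates of exactly one `(x, w)`, and then `x ∈ M` is at geodesic distance less than `δ` from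
`xs` and `w ∈ T_x M`. -/
structure CoordsWellDefined (c : Fin m → E d → ℝ) (xs : E d) (r r1 δ : ℝ) : Prop where
  coords_unique : ∀ x w p p', IsCoord c xs r x w p → IsCoord c xs r x w p' → p = p'
  coords_exist : ∀ x ∈ feasible c, geodesicDist c x xs < ENNReal.ofReal r1 →
    ∀ w ∈ tangent c x, ∃ p, IsCoord c xs r x w p
  point : ∀ p : E d × E d, p.1 ∈ tangent c xs → p.2 ∈ tangent c xs → ‖p.1‖ < r →
    ∃! y : E d × E d, IsCoord c xs r y.1 y.2 p
  point_mem : ∀ x w p, IsCoord c xs r x w p →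
    x ∈ feasible c ∧ geodesicDist c x xs < ENNReal.ofReal δ ∧ w ∈ tangent c x

/-- In the coordinates of radius `r`, one step of the iteration is `A` up to a remainder bounded by
`C (‖ζ‖² + ‖ρ‖²)`, as long as `√(‖ζ‖² + ‖ρ‖²) < rs`; in particular a step from such a pair
exists and leads to a pair that has coordinates of radius `r`. -/
structure StepExpansion (c : Fin m → E d → ℝ) (f : E d → ℝ) (hk : k ≤ d - m) (dt γ : ℝ)
    (xs : E d) (A : (E d × E d) →L[ℝ] (E d × E d)) (r C rs : ℝ) : Prop where
  exists_step : ∀ x w p, IsCoord c xs r x w p → pairNorm p < rs →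
    ∃ v x' w', IsStep c f hk dt γ x w v x' w'
  expansion : ∀ x w p, IsCoord c xs r x w p → pairNorm p < rs →
    ∀ v x' w', IsStep c f hk dt γ x w v x' w' →
      ∃ p', IsCoord c xs r x' w' p' ∧ pairNorm (p' - A p) ≤ C * pairNorm p ^ 2

end MCSD

end

namespace MCSD

variable {d m k : ℕ}

/-! ### Smoothness of the tangent projector in an ambient neighbourhood. -/

section ProjRegularity

variable {c : Fin m → E d → ℝ}

/-! All the geometry is done in the ambient space. Near `xs` the projector field `P` is smooth, and
differentiating `P(g) V = V` turns the condition that `V` is parallel along `g` into the equation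
`V' = DP(g)[g'] V`, with `V = g'` for a geodesic. This gives existence by Picard–Lindelöf,
uniqueness and comparison of geodesics by Gronwall, and the estimates `exp_x(u) = x + u + O(‖u‖²)`
and transport = identity + `O(‖u‖)` (`ExpTransport.estimates`).

Two further facts linearise the step: `grad f` has derivative `Hess f` at the critical point, and
the reflection in the unstable eigenspace is Lipschitz in the operator, by a Davis–Kahan argument
based on the spectral gap. The change of the reflection is `O(‖ζ‖)` and acts on a gradient of size
`O(‖ζ‖)`. So in coordinates a step is `A` plus a quadratic remainder (`exists_stepExpansion`).

On the eigenvectors of `H*` the operator `R* H*` has eigenvalues `a = |λ|` in `[μ, L]`, and `A`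
splits into 2×2 blocks with trace `1 + γ - Δt a` and determinant `γ = β²`, where `β = (√L - √μ)/(√L
+ √μ)`. The choice of `Δt` and `γ` makes the trace at most `2β` in absolute value, so all
eigenvalues of `A` have modulus `β < q`. The margin `q - β` absorbs the Jordan blocks at `a = μ` and
`a = L` (`exists_isPowerBound`).

Finally, the remainders along a run are of order `q^(2j)`. Propagated by powers of `A`, they add up
to a geometric series that at most doubles the linear bound; this is why `Ch > 2 C0` is needed
(`pairNorm_pow_le_of_quadratic`, `partialRun_bound`). -/

theorem contDiff_gradient {f : E d → ℝ} (hf : ContDiff ℝ ∞ f) : ContDiff ℝ ∞ (gradient f) := by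
  have h : ContDiff ℝ ∞ (fderiv ℝ f) := hf.fderiv_right (by simp)
  exact ((InnerProductSpace.toDual ℝ (E d)).symm.toContinuousLinearEquiv.contDiff).comp h

/-- The synthesis operator `a ↦ ∑ a_i w_i` of a finite family of vectors. -/
noncomputable def synthesis (w : Fin m → E d) : (Fin m → ℝ) →L[ℝ] E d :=
  ∑ i, (ContinuousLinearMap.proj (R := ℝ) (φ := fun _ : Fin m => ℝ) i).smulRight (w i)

/-- The analysis operator `y ↦ (⟪w_i, y⟫)_i` of a finite family of vectors. -/
noncomputable def analysis (w : Fin m → E d) : E d →L[ℝ] (Fin m → ℝ) :=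
  ContinuousLinearMap.pi fun i => innerSL ℝ (w i)

@[simp] theorem synthesis_apply (w : Fin m → E d) (a : Fin m → ℝ) :
    synthesis w a = ∑ i, a i • w i := by
  simp [synthesis]

@[simp] theorem analysis_apply (w : Fin m → E d) (y : E d) (i : Fin m) :
    analysis w y i = inner ℝ (w i) y := by
  simp [analysis]

theorem contDiff_synthesis : ContDiff ℝ ∞ (synthesis (d := d) (m := m)) := by
  unfold synthesis
  refine ContDiff.sum fun i _ => ?_
  exact (ContinuousLinearMap.smulRightL ℝ (Fin m → ℝ) (E d)
    (ContinuousLinearMap.proj (R := ℝ) (φ := fun _ : Fin m => ℝ) i)).contDiff.comp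
    (contDiff_apply ℝ (E d) i)

theorem contDiff_analysis : ContDiff ℝ ∞ (analysis (d := d) (m := m)) := by
  have h : ∀ w : Fin m → E d, analysis w =
      ∑ i, (ContinuousLinearMap.compL ℝ (E d) ℝ (Fin m → ℝ)
        (ContinuousLinearMap.single ℝ (fun _ : Fin m => ℝ) i)) (innerSL ℝ (w i)) := by
    intro w
    ext y j
    simp [Finset.sum_apply, Pi.single_apply]
  rw [funext h]
  refine ContDiff.sum fun i _ => ?_
  exact (ContinuousLinearMap.contDiff _).comp
    ((innerSL ℝ (E := E d)).contDiff.comp (contDiff_apply ℝ (E d) i))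

theorem isUnit_gram {w : Fin m → E d} (hw : LinearIndependent ℝ w) :
    IsUnit ((analysis w).comp (synthesis w)) := by
  have hinj : Function.Injective ((analysis w).comp (synthesis w)) := by
    rw [injective_iff_map_eq_zero]
    intro a ha
    have h1 : inner ℝ (synthesis w a) (synthesis w a) = 0 := by
      conv_lhs => rw [synthesis_apply w a, sum_inner]
      refine Finset.sum_eq_zero fun i _ => ?_
      have := congrFun ha i
      rw [real_inner_smul_left, ← synthesis_apply, ← analysis_apply]
      simp only [ContinuousLinearMap.comp_apply, Pi.zero_apply] at this
      rw [this, mul_zero]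
    have h2 : synthesis w a = 0 := inner_self_eq_zero.mp h1
    rw [synthesis_apply] at h2
    funext i
    exact Fintype.linearIndependent_iff.mp hw a h2 i
  rw [ContinuousLinearMap.isUnit_iff_bijective]
  exact ⟨hinj, (LinearMap.injective_iff_surjective
    (f := ((analysis w).comp (synthesis w)).toLinearMap)).mp hinj⟩

/-- The formula `P = I - S G⁻¹ S*`, with Gram operator `G = S* S`, shows how `P` depends on the
constraint gradients; the tangent spaces themselves carry no smooth structure to differentiate. -/
theorem starProjection_eq_of_isUnit {w : Fin m → E d}
    (hw : IsUnit ((analysis w).comp (synthesis w))) :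
    (Submodule.span ℝ (Set.range w))ᗮ.starProjection = ContinuousLinearMap.id ℝ (E d) -
      (synthesis w).comp ((Ring.inverse ((analysis w).comp (synthesis w))).comp (analysis w)) := by
  ext1 y
  set G := (analysis w).comp (synthesis w)
  refine Submodule.eq_starProjection_of_mem_orthogonal ?_ ?_
  · have h : analysis w (y - synthesis w (Ring.inverse G (analysis w y))) = 0 := by
      have : (G * Ring.inverse G) (analysis w y) = analysis w y := by
        rw [Ring.mul_inverse_cancel _ hw]; rfl
      rw [map_sub, sub_eq_zero]
      exact this.symm
    rw [Submodule.mem_orthogonal]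
    intro u hu
    induction hu using Submodule.span_induction with
    | mem x hx =>
      obtain ⟨i, rfl⟩ := hx
      have := congrFun h i
      simpa using this
    | zero => simp
    | add x z _ _ hx hz => rw [inner_add_left, hx, hz, add_zero]
    | smul a x _ hx => rw [real_inner_smul_left, hx, mul_zero]
  · refine Submodule.le_orthogonal_orthogonal _ ?_
    have : y - (ContinuousLinearMap.id ℝ (E d) - (synthesis w).comp
        ((Ring.inverse G).comp (analysis w))) y =
        synthesis w (Ring.inverse G (analysis w y)) := by simp
    rw [this, synthesis_apply]
    exact Submodule.sum_mem _ fun i _ =>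
      Submodule.smul_mem _ _ (Submodule.subset_span (Set.mem_range_self i))

/-- Invertibility of the Gram operator is an open condition, so independence of the gradients at `x`
alone makes `P` smooth on a full ambient neighbourhood, infeasible points included. -/
theorem contDiffAt_proj (hc : ∀ i, ContDiff ℝ ∞ (c i)) {x : E d}
    (hx : LinearIndependent ℝ (fun i => gradient (c i) x)) : ContDiffAt ℝ ∞ (proj c) x := by
  set w : E d → Fin m → E d := fun x i => gradient (c i) x
  have hw : ContDiff ℝ ∞ w := contDiff_pi.mpr fun i => contDiff_gradient (hc i)
  have hS : ContDiff ℝ ∞ fun x => synthesis (w x) := contDiff_synthesis.comp hw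
  have hA : ContDiff ℝ ∞ fun x => analysis (w x) := contDiff_analysis.comp hw
  have hG : ContDiff ℝ ∞ fun x => (analysis (w x)).comp (synthesis (w x)) := hA.clm_comp hS
  have hu : IsUnit ((analysis (w x)).comp (synthesis (w x))) := isUnit_gram hx
  have hev : ∀ᶠ y in 𝓝 x, IsUnit ((analysis (w y)).comp (synthesis (w y))) :=
    hG.continuous.continuousAt.eventually (Units.isOpen.mem_nhds hu)
  have hI : ContDiffAt ℝ ∞ (fun y => Ring.inverse ((analysis (w y)).comp (synthesis (w y)))) x := by
    obtain ⟨U, hU⟩ := hu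
    have h := contDiffAt_ringInverse ℝ (n := ∞) U
    rw [hU] at h
    exact h.comp x hG.contDiffAt
  have hF : ContDiffAt ℝ ∞ (fun y => ContinuousLinearMap.id ℝ (E d) - (synthesis (w y)).comp
      ((Ring.inverse ((analysis (w y)).comp (synthesis (w y)))).comp (analysis (w y)))) x :=
    contDiffAt_const.sub (hS.contDiffAt.clm_comp (hI.clm_comp hA.contDiffAt))
  refine hF.congr_of_eventuallyEq ?_
  filter_upwards [hev] with y hy
  exact starProjection_eq_of_isUnit hy

/-- On the ball of radius `ε` around `xs` the projector field is differentiable, with derivative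
bounded by `B` and Lipschitz with constant `B`. -/
structure IsTube (c : Fin m → E d → ℝ) (xs : E d) (ε B : ℝ) : Prop where
  pos : 0 < ε
  nonneg : 0 ≤ B
  diff : ∀ x ∈ Metric.ball xs ε, DifferentiableAt ℝ (proj c) x
  bound : ∀ x ∈ Metric.ball xs ε, ‖fderiv ℝ (proj c) x‖ ≤ B
  lip : ∀ x ∈ Metric.ball xs ε, ∀ y ∈ Metric.ball xs ε,
    ‖fderiv ℝ (proj c) x - fderiv ℝ (proj c) y‖ ≤ B * ‖x - y‖
  cont : ContinuousOn (fderiv ℝ (proj c)) (Metric.ball xs ε)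

theorem exists_isTube (hc : ∀ i, ContDiff ℝ ∞ (c i)) {xs : E d}
    (hx : LinearIndependent ℝ (fun i => gradient (c i) xs)) : ∃ ε B, IsTube c xs ε B := by
  have hP := contDiffAt_proj hc hx
  have hD : ContDiffAt ℝ 1 (fderiv ℝ (proj c)) xs :=
    hP.fderiv_right (m := 1) (by norm_cast)
  obtain ⟨K, s, hs, hK⟩ := hD.exists_lipschitzOnWith
  have hd : ∀ᶠ x in 𝓝 xs, DifferentiableAt ℝ (proj c) x := by
    have h1 : ContDiffAt ℝ 1 (proj c) xs := hP.of_le (by norm_cast)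
    filter_upwards [h1.eventually (by simp)] with x h
    exact h.differentiableAt (by simp)
  obtain ⟨ε, hε, h⟩ := Metric.eventually_nhds_iff_ball.mp
    ((Metric.eventually_nhds_iff_ball.mpr ⟨1, one_pos, fun _ hx => hx⟩).and (hd.and hs))
  -- The ball lies in the unit ball, so the Lipschitz constant `K` of the derivative also bounds its
  -- growth from the centre; one constant serves both purposes.
  refine ⟨ε, ‖fderiv ℝ (proj c) xs‖ + K, hε, by positivity, fun x hx => (h x hx).2.1,
    fun x hx => ?_, fun x hx y hy => ?_,
    hK.continuousOn.mono fun x hx => (h x hx).2.2⟩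
  · have h1 := hK.norm_sub_le (h x hx).2.2 (mem_of_mem_nhds hs)
    have h2 : ‖x - xs‖ ≤ 1 := (mem_ball_iff_norm.mp (h x hx).1).le
    have h3 : (K : ℝ) * ‖x - xs‖ ≤ K * 1 := by gcongr
    have h4 := norm_le_norm_add_norm_sub' (fderiv ℝ (proj c) x) (fderiv ℝ (proj c) xs)
    linarith
  · refine (hK.norm_sub_le (h x hx).2.2 (h y hy).2.2).trans ?_
    gcongr
    exact le_add_of_nonneg_left (by positivity)

end ProjRegularity

/-! ### A priori estimates for geodesics and parallel fields. -/

section Curves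

variable {c : Fin m → E d → ℝ} {g V : ℝ → E d} {t : ℝ}

theorem uniqueDiffWithinAt_unitInterval (ht : t ∈ Icc (0 : ℝ) 1) :
    UniqueDiffWithinAt ℝ (Icc (0 : ℝ) 1) t :=
  uniqueDiffOn_Icc zero_lt_one t ht

theorem hasDerivWithinAt_Ici_of_Icc {F : Type*} [NormedAddCommGroup F] [NormedSpace ℝ F]
    {f : ℝ → F} {f' : F} {a b : ℝ} (ht : t ∈ Ico a b) (h : HasDerivWithinAt f f' (Icc a b) t) :
    HasDerivWithinAt f f' (Ici t) t :=
  h.mono_of_mem_nhdsWithin (Icc_mem_nhdsGE_of_mem ht)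

theorem proj_eq_self_iff {x v : E d} : proj c x v = v ↔ v ∈ tangent c x :=
  Submodule.starProjection_eq_self_iff

theorem proj_mem (x v : E d) : proj c x v ∈ tangent c x :=
  Submodule.starProjection_apply_mem _ _

theorem inner_proj_left {x v w : E d} (hw : w ∈ tangent c x) :
    inner ℝ (proj c x v) w = inner ℝ v w := by
  have := Submodule.starProjection_inner_eq_zero (K := tangent c x) v w hw
  rw [inner_sub_left, sub_eq_zero] at this
  exact this.symm

theorem proj_proj (x v : E d) : proj c x (proj c x v) = proj c x v :=
  proj_eq_self_iff.mpr (proj_mem x v)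

theorem norm_proj_le (x v : E d) : ‖proj c x v‖ ≤ ‖v‖ :=
  Submodule.norm_starProjection_apply_le _ _

theorem mem_tangent_iff {x v : E d} : v ∈ tangent c x ↔ ∀ i, inner ℝ (gradient (c i) x) v = 0 := by
  unfold tangent
  rw [Submodule.mem_orthogonal]
  refine ⟨fun h i => h _ (Submodule.subset_span (mem_range_self i)), fun h u hu => ?_⟩
  induction hu using Submodule.span_induction with
  | mem x hx => obtain ⟨i, rfl⟩ := hx; exact h i
  | zero => simp
  | add x z _ _ hx hz => rw [inner_add_left, hx, hz, add_zero]
  | smul a x _ hx => rw [real_inner_smul_left, hx, mul_zero]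

theorem IsParallel.hasDerivWithinAt (hV : IsParallel c g V) (ht : t ∈ Icc (0 : ℝ) 1) :
    HasDerivWithinAt V (derivWithin V (Icc 0 1) t) (Icc 0 1) t :=
  (hV.smooth.differentiableOn (by simp) t ht).hasDerivWithinAt

/-- `V'` is normal and `V` is tangent, so `⟪V, V⟫` has zero derivative. -/
theorem IsParallel.norm_eq (hV : IsParallel c g V) (ht : t ∈ Icc (0 : ℝ) 1) :
    ‖V t‖ = ‖V 0‖ := by
  have hd : ∀ s ∈ Icc (0 : ℝ) 1,
      HasDerivWithinAt (fun s => inner ℝ (V s) (V s)) 0 (Icc 0 1) s := by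
    intro s hs
    have h := (hV.hasDerivWithinAt hs).inner ℝ (hV.hasDerivWithinAt hs)
    have h0 : inner ℝ (derivWithin V (Icc 0 1) s) (V s) = 0 := by
      rw [← inner_proj_left (hV.tangent s hs)]
      have := hV.parallel s hs
      rw [covDeriv] at this
      rw [this, inner_zero_left]
    rwa [real_inner_comm, h0, add_zero] at h
  have := constant_of_derivWithin_zero (fun s hs => (hd s hs).differentiableWithinAt)
    (fun s hs => (hd s (Ico_subset_Icc_self hs)).derivWithin
      (uniqueDiffWithinAt_unitInterval (Ico_subset_Icc_self hs))) t ht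
  rw [real_inner_self_eq_norm_sq, real_inner_self_eq_norm_sq] at this
  exact (pow_left_inj₀ (norm_nonneg _) (norm_nonneg _) two_ne_zero).mp this

theorem IsGeodesic.hasDerivWithinAt (hg : IsGeodesic c g) (ht : t ∈ Icc (0 : ℝ) 1) :
    HasDerivWithinAt g (derivWithin g (Icc 0 1) t) (Icc 0 1) t :=
  (hg.smooth.differentiableOn (by simp) t ht).hasDerivWithinAt

theorem derivWithin_mem_tangent (hc : ∀ i, ContDiff ℝ ∞ (c i))
    (hg : ∀ s ∈ Icc (0 : ℝ) 1, g s ∈ feasible c) (ht : t ∈ Icc (0 : ℝ) 1) {v : E d}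
    (hd : HasDerivWithinAt g v (Icc 0 1) t) : v ∈ tangent c (g t) := by
  rw [mem_tangent_iff]
  intro i
  have h1 : HasDerivWithinAt (fun s => c i (g s)) (fderiv ℝ (c i) (g t) v) (Icc 0 1) t :=
    (((hc i).differentiable (by simp) (g t)).hasFDerivAt).comp_hasDerivWithinAt t hd
  have h2 : HasDerivWithinAt (fun s => c i (g s)) 0 (Icc 0 1) t :=
    (hasDerivWithinAt_const t (Icc 0 1) (0 : ℝ)).congr (fun s hs => hg s hs i) (hg t ht i)
  rw [inner_gradient_left]
  exact (uniqueDiffWithinAt_unitInterval ht).eq_deriv _ h1 h2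

theorem IsGeodesic.isParallel (hc : ∀ i, ContDiff ℝ ∞ (c i)) (hg : IsGeodesic c g) :
    IsParallel c g (derivWithin g (Icc 0 1)) where
  smooth := hg.smooth.derivWithin (uniqueDiffOn_Icc zero_lt_one) (by norm_num)
  tangent t ht := derivWithin_mem_tangent hc hg.feasible ht (hg.hasDerivWithinAt ht)
  parallel := hg.geodesic

theorem IsGeodesic.norm_sub_le (hc : ∀ i, ContDiff ℝ ∞ (c i)) (hg : IsGeodesic c g)
    (ht : t ∈ Icc (0 : ℝ) 1) : ‖g t - g 0‖ ≤ ‖derivWithin g (Icc 0 1) 0‖ := by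
  have h := norm_image_sub_le_of_norm_deriv_le_segment'
    (fun s hs => hg.hasDerivWithinAt hs)
    (fun s hs => ((hg.isParallel hc).norm_eq (Ico_subset_Icc_self hs)).le) t ht
  refine h.trans (mul_le_of_le_one_right (norm_nonneg _) ?_)
  linarith [ht.2]

theorem IsGeodesic.mapsTo_ball (hc : ∀ i, ContDiff ℝ ∞ (c i)) (hg : IsGeodesic c g) {xs : E d}
    {ε : ℝ} (h : ‖g 0 - xs‖ + ‖derivWithin g (Icc 0 1) 0‖ < ε) :
    ∀ t ∈ Icc (0 : ℝ) 1, g t ∈ Metric.ball xs ε := by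
  intro t ht
  rw [mem_ball_iff_norm]
  have := hg.norm_sub_le hc ht
  have := norm_sub_le_norm_sub_add_norm_sub (g t) (g 0) xs
  linarith

/-- Differentiating `P(g) V = V` gives `V' = DP(g)[g'] V + P(g) V'`, and the last term is the
covariant derivative. Parallelism thus becomes a linear equation in the ambient space. -/
theorem IsParallel.derivWithin_eq (hV : IsParallel c g V) (ht : t ∈ Icc (0 : ℝ) 1)
    (hP : DifferentiableAt ℝ (proj c) (g t)) {v : E d} (hg : HasDerivWithinAt g v (Icc 0 1) t) :
    derivWithin V (Icc 0 1) t = fderiv ℝ (proj c) (g t) v (V t) := by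
  have h1 : HasDerivWithinAt (fun s => proj c (g s)) (fderiv ℝ (proj c) (g t) v) (Icc 0 1) t :=
    hP.hasFDerivAt.comp_hasDerivWithinAt t hg
  have h2 := h1.clm_apply (hV.hasDerivWithinAt ht)
  have h3 : HasDerivWithinAt V (fderiv ℝ (proj c) (g t) v (V t) +
      proj c (g t) (derivWithin V (Icc 0 1) t)) (Icc 0 1) t :=
    h2.congr (fun s hs => (proj_eq_self_iff.mpr (hV.tangent s hs)).symm)
      (proj_eq_self_iff.mpr (hV.tangent t ht)).symm
  have h4 : proj c (g t) (derivWithin V (Icc 0 1) t) = 0 := hV.parallel t ht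
  rw [h4, add_zero] at h3
  exact h3.derivWithin (uniqueDiffWithinAt_unitInterval ht)

variable {xs : E d} {ε B : ℝ}

theorem IsTube.bound_apply (hT : IsTube c xs ε B) {x : E d} (hx : x ∈ Metric.ball xs ε)
    (v w : E d) : ‖fderiv ℝ (proj c) x v w‖ ≤ B * ‖v‖ * ‖w‖ := by
  refine (ContinuousLinearMap.le_opNorm₂ _ v w).trans ?_
  gcongr
  exact hT.bound x hx

theorem IsParallel.norm_sub_le (hc : ∀ i, ContDiff ℝ ∞ (c i)) (hT : IsTube c xs ε B)
    (hg : IsGeodesic c g) (hV : IsParallel c g V)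
    (hgε : ∀ t ∈ Icc (0 : ℝ) 1, g t ∈ Metric.ball xs ε) (ht : t ∈ Icc (0 : ℝ) 1) :
    ‖V t - V 0‖ ≤ B * ‖derivWithin g (Icc 0 1) 0‖ * ‖V 0‖ := by
  have hB := hT.nonneg
  have h := norm_image_sub_le_of_norm_deriv_le_segment' (C :=
      B * ‖derivWithin g (Icc 0 1) 0‖ * ‖V 0‖)
    (fun s hs => hV.hasDerivWithinAt hs) (fun s hs => ?_) t ht
  · refine h.trans (mul_le_of_le_one_right (by positivity) ?_)
    linarith [ht.2]
  · have hs' := Ico_subset_Icc_self hs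
    rw [hV.derivWithin_eq hs' (hT.diff _ (hgε s hs')) (hg.hasDerivWithinAt hs')]
    refine (hT.bound_apply (hgε s hs') _ _).trans ?_
    rw [(hg.isParallel hc).norm_eq hs', hV.norm_eq hs']

theorem IsGeodesic.norm_sub_sub_le (hc : ∀ i, ContDiff ℝ ∞ (c i)) (hT : IsTube c xs ε B)
    (hg : IsGeodesic c g) (hgε : ∀ t ∈ Icc (0 : ℝ) 1, g t ∈ Metric.ball xs ε) :
    ‖g 1 - g 0 - derivWithin g (Icc 0 1) 0‖ ≤ B * ‖derivWithin g (Icc 0 1) 0‖ ^ 2 := by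
  set u := derivWithin g (Icc 0 1) 0 with hu
  have h := norm_image_sub_le_of_norm_deriv_le_segment_01' (C := B * ‖u‖ ^ 2)
    (f := fun s => g s - s • u) (f' := fun s => derivWithin g (Icc 0 1) s - u)
    (fun s hs => ?_) (fun s hs => ?_)
  · have e : g 1 - g 0 - u = g 1 - (1 : ℝ) • u - (g 0 - (0 : ℝ) • u) := by
      rw [one_smul, zero_smul]; abel
    rw [e]
    exact h
  · simpa using (hg.hasDerivWithinAt hs).fun_sub ((hasDerivWithinAt_id s (Icc 0 1)).smul_const u)
  · have := (hg.isParallel hc).norm_sub_le hc hT hg hgε (Ico_subset_Icc_self hs)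
    rwa [mul_assoc, ← pow_two] at this

/-- Gronwall comparison of two geodesics starting at the same point. -/
theorem IsGeodesic.norm_sub_sub_smul_le (hc : ∀ i, ContDiff ℝ ∞ (c i)) (hT : IsTube c xs ε B)
    {g₁ g₂ : ℝ → E d} (hg₁ : IsGeodesic c g₁) (hg₂ : IsGeodesic c g₂)
    (h₁ : ∀ t ∈ Icc (0 : ℝ) 1, g₁ t ∈ Metric.ball xs ε)
    (h₂ : ∀ t ∈ Icc (0 : ℝ) 1, g₂ t ∈ Metric.ball xs ε) (h0 : g₁ 0 = g₂ 0) {s : ℝ} (hs1 : s ≤ 1)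
    (hu₁ : ‖derivWithin g₁ (Icc 0 1) 0‖ ≤ s) (hu₂ : ‖derivWithin g₂ (Icc 0 1) 0‖ ≤ s)
    (ht : t ∈ Icc (0 : ℝ) 1) :
    ‖g₁ t - g₂ t - t • (derivWithin g₁ (Icc 0 1) 0 - derivWithin g₂ (Icc 0 1) 0)‖ ≤
      3 * B * Real.exp (1 + 3 * B) * s *
        ‖derivWithin g₁ (Icc 0 1) 0 - derivWithin g₂ (Icc 0 1) 0‖ := by
  have hB := hT.nonneg
  have hs0 : 0 ≤ s := (norm_nonneg _).trans hu₁
  set v₁ := derivWithin g₁ (Icc 0 1)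
  set v₂ := derivWithin g₂ (Icc 0 1)
  have hp₁ := hg₁.isParallel hc
  have hp₂ := hg₂.isParallel hc
  -- The right-hand side `DP(g)[v] v` is split by changing one of its three arguments at a time;
  -- each piece keeps a factor `s` because speeds are constant, and `s ≤ 1` reduces `s²` to `s`.
  have key : ∀ t ∈ Icc (0 : ℝ) 1,
      ‖derivWithin v₁ (Icc 0 1) t - derivWithin v₂ (Icc 0 1) t‖ ≤
        3 * B * s * ‖(g₁ t - g₂ t, v₁ t - v₂ t)‖ := by
    intro t ht
    rw [hp₁.derivWithin_eq ht (hT.diff _ (h₁ t ht)) (hg₁.hasDerivWithinAt ht),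
      hp₂.derivWithin_eq ht (hT.diff _ (h₂ t ht)) (hg₂.hasDerivWithinAt ht)]
    change ‖fderiv ℝ (proj c) (g₁ t) (v₁ t) (v₁ t) - fderiv ℝ (proj c) (g₂ t) (v₂ t) (v₂ t)‖ ≤ _
    have hn₁ : ‖v₁ t‖ ≤ s := (hp₁.norm_eq ht).le.trans hu₁
    have hn₂ : ‖v₂ t‖ ≤ s := (hp₂.norm_eq ht).le.trans hu₂
    have ha : ‖g₁ t - g₂ t‖ ≤ ‖(g₁ t - g₂ t, v₁ t - v₂ t)‖ := norm_fst_le (g₁ t - g₂ t, v₁ t - v₂ t)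
    have hb : ‖v₁ t - v₂ t‖ ≤ ‖(g₁ t - g₂ t, v₁ t - v₂ t)‖ := norm_snd_le (g₁ t - g₂ t, v₁ t - v₂ t)
    set e := ‖(g₁ t - g₂ t, v₁ t - v₂ t)‖
    have he : 0 ≤ e := norm_nonneg _
    have e1 : fderiv ℝ (proj c) (g₁ t) (v₁ t) (v₁ t) - fderiv ℝ (proj c) (g₂ t) (v₂ t) (v₂ t) =
        (fderiv ℝ (proj c) (g₁ t) - fderiv ℝ (proj c) (g₂ t)) (v₁ t) (v₁ t) +
        (fderiv ℝ (proj c) (g₂ t) (v₁ t - v₂ t) (v₁ t) +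
          fderiv ℝ (proj c) (g₂ t) (v₂ t) (v₁ t - v₂ t)) := by
      simp only [sub_apply, map_sub]; abel
    rw [e1]
    have i1 : ‖(fderiv ℝ (proj c) (g₁ t) - fderiv ℝ (proj c) (g₂ t)) (v₁ t) (v₁ t)‖ ≤
        B * e * s * 1 := by
      refine (ContinuousLinearMap.le_opNorm₂ _ _ _).trans ?_
      gcongr
      · exact (hT.lip _ (h₁ t ht) _ (h₂ t ht)).trans (by gcongr)
      · exact hn₁.trans hs1
    have i2 : ‖fderiv ℝ (proj c) (g₂ t) (v₁ t - v₂ t) (v₁ t)‖ ≤ B * e * s :=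
      (hT.bound_apply (h₂ t ht) _ _).trans (by gcongr)
    have i3 : ‖fderiv ℝ (proj c) (g₂ t) (v₂ t) (v₁ t - v₂ t)‖ ≤ B * s * e :=
      (hT.bound_apply (h₂ t ht) _ _).trans (by gcongr)
    refine (norm_add_le _ _).trans ((add_le_add i1 ((norm_add_le _ _).trans (add_le_add i2 i3))).trans ?_)
    linarith
  have hder : ∀ t ∈ Icc (0 : ℝ) 1, HasDerivWithinAt (fun t => (g₁ t - g₂ t, v₁ t - v₂ t))
      (v₁ t - v₂ t, derivWithin v₁ (Icc 0 1) t - derivWithin v₂ (Icc 0 1) t) (Icc 0 1) t :=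
    fun t ht => ((hg₁.hasDerivWithinAt ht).sub (hg₂.hasDerivWithinAt ht)).prodMk
      ((hp₁.hasDerivWithinAt ht).sub (hp₂.hasDerivWithinAt ht))
  have hgr : ∀ t ∈ Icc (0 : ℝ) 1, ‖(g₁ t - g₂ t, v₁ t - v₂ t)‖ ≤
      ‖v₁ 0 - v₂ 0‖ * Real.exp (1 + 3 * B) := by
    intro t ht
    have h := norm_le_gronwallBound_of_norm_deriv_right_le (δ := ‖v₁ 0 - v₂ 0‖) (K := 1 + 3 * B)
      (ε := 0) (fun t ht => (hder t ht).continuousWithinAt)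
      (fun t ht => hasDerivWithinAt_Ici_of_Icc ht (hder t (Ico_subset_Icc_self ht)))
      (by simp [h0]) (fun t ht => ?_) t ht
    · refine h.trans ?_
      rw [gronwallBound_ε0]
      gcongr
      have := ht.2
      nlinarith
    · have ht' := Ico_subset_Icc_self ht
      have hk := key t ht'
      have hb : ‖v₁ t - v₂ t‖ ≤ ‖(g₁ t - g₂ t, v₁ t - v₂ t)‖ :=
        norm_snd_le (g₁ t - g₂ t, v₁ t - v₂ t)
      set e := ‖(g₁ t - g₂ t, v₁ t - v₂ t)‖
      have he : 0 ≤ e := norm_nonneg _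
      rw [Prod.norm_mk, add_zero]
      refine max_le (hb.trans ?_) (hk.trans ?_)
      · nlinarith [mul_nonneg hB he]
      · have : 3 * B * s * e ≤ 3 * B * 1 * e := by gcongr
        linarith
  -- Feeding the Gronwall bound back into `key` recovers the factor `s`. It makes the exponential
  -- map a small perturbation of the identity on small balls.
  set C := 3 * B * Real.exp (1 + 3 * B) * s * ‖v₁ 0 - v₂ 0‖ with hC
  have hC0 : 0 ≤ C := by positivity
  have hv : ∀ t ∈ Icc (0 : ℝ) 1, ‖v₁ t - v₂ t - (v₁ 0 - v₂ 0)‖ ≤ C := by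
    intro t ht
    have h := norm_image_sub_le_of_norm_deriv_le_segment' (C := C) (f := fun t => v₁ t - v₂ t)
      (fun s hs => (hp₁.hasDerivWithinAt hs).sub (hp₂.hasDerivWithinAt hs))
      (fun r hr => ?_) t ht
    · exact h.trans (mul_le_of_le_one_right hC0 (by linarith [ht.2]))
    · have hr' := Ico_subset_Icc_self hr
      refine (key r hr').trans ((mul_le_mul_of_nonneg_left (hgr r hr') (by positivity)).trans_eq ?_)
      rw [hC]; ring
  have h := norm_image_sub_le_of_norm_deriv_le_segment' (C := C)
    (f := fun t => g₁ t - g₂ t - t • (v₁ 0 - v₂ 0)) (f' := fun t => v₁ t - v₂ t - (v₁ 0 - v₂ 0))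
    (fun s hs => ?_) (fun s hs => hv s (Ico_subset_Icc_self hs)) t ht
  · simp only [h0, sub_self, zero_smul, sub_zero] at h
    exact h.trans (mul_le_of_le_one_right hC0 ht.2)
  · simpa using ((hg₁.hasDerivWithinAt hs).fun_sub (hg₂.hasDerivWithinAt hs)).fun_sub
      ((hasDerivWithinAt_id s (Icc 0 1)).smul_const (v₁ 0 - v₂ 0))

end Curves

/-! ### Existence of short geodesics and of parallel transport along them. -/

section ExpExistence

/-- The local flow of a `C¹` vector field, run for a short time, stays in a prescribed
neighbourhood. -/
theorem exists_local_flow_mem {X : Type*} [NormedAddCommGroup X] [NormedSpace ℝ X]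
    [CompleteSpace X] {F : X → X} {z₀ : X} (hF : ContDiffAt ℝ 1 F z₀) {U : Set X}
    (hU : U ∈ 𝓝 z₀) : ∃ r > 0, ∃ ε > 0, ∀ z ∈ Metric.ball z₀ r, ∃ α : ℝ → X, α 0 = z ∧
      ∀ t ∈ Icc (0 : ℝ) ε, α t ∈ U ∧ HasDerivWithinAt α (F (α t)) (Icc 0 ε) t := by
  obtain ⟨ε, hε, a, r, L, K, hr, h⟩ := IsPicardLindelof.of_contDiffAt_one hF
  obtain ⟨α, hα, hcont⟩ := (h 0).exists_forall_mem_closedBall_eq_hasDerivWithinAt_continuousOn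
  have hz : z₀ ∈ Metric.closedBall z₀ (r : ℝ) := Metric.mem_closedBall_self r.2
  have h00 : (0 : ℝ) ∈ Icc (0 - ε) (0 + ε) := ⟨by linarith, by linarith⟩
  have hc0 := hcont (z₀, 0) ⟨hz, h00⟩
  have hα0 : α (z₀, 0) = z₀ := (hα z₀ hz).1
  -- Joint continuity at `(z₀, 0)` keeps all nearby orbits in `U` for a common short time.
  have hmem : α ⁻¹' U ∈ 𝓝[Metric.closedBall z₀ (r : ℝ) ×ˢ Icc (0 - ε) (0 + ε)] (z₀, 0) :=
    hc0 (by rwa [hα0])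
  obtain ⟨δ, hδ, hsub⟩ := Metric.mem_nhdsWithin_iff.mp hmem
  refine ⟨min r δ, lt_min hr hδ, min ε (δ / 2), lt_min hε (by linarith), fun z hz => ?_⟩
  have hz1 : z ∈ Metric.closedBall z₀ (r : ℝ) :=
    Metric.ball_subset_closedBall (Metric.ball_subset_ball (min_le_left _ _) hz)
  have hz2 : dist z z₀ < δ := lt_of_lt_of_le hz (min_le_right _ _)
  refine ⟨fun t => α (z, t), (hα z hz1).1, fun t ht => ?_⟩
  have hsubset : Icc (0 : ℝ) (min ε (δ / 2)) ⊆ Icc (0 - ε) (0 + ε) := fun s hs =>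
    ⟨by linarith [hs.1], by linarith [hs.2, min_le_left ε (δ / 2)]⟩
  refine ⟨hsub ⟨?_, hz1, hsubset ht⟩, ((hα z hz1).2 t (hsubset ht)).mono hsubset⟩
  rw [Metric.mem_ball, Prod.dist_eq]
  refine max_lt hz2 ?_
  simp only [Real.dist_eq, sub_zero, abs_of_nonneg ht.1]
  linarith [ht.2, min_le_right ε (δ / 2)]

variable {c : Fin m → E d → ℝ} {xs : E d} {ε B : ℝ}

/-- Differentiating `P² = P` gives `DP P + P DP = DP`; multiplying by `P` on both sides leaves `P DP
P = 0`. So `DP` maps tangent vectors to normal ones. -/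
theorem proj_fderiv_proj {x : E d} (hP : DifferentiableAt ℝ (proj c) x) (v w : E d) :
    proj c x (fderiv ℝ (proj c) x v (proj c x w)) = 0 := by
  have key : ∀ w, fderiv ℝ (proj c) x v (proj c x w) + proj c x (fderiv ℝ (proj c) x v w) =
      fderiv ℝ (proj c) x v w := by
    intro w
    have h1 : HasFDerivAt (fun y => proj c y w) ((fderiv ℝ (proj c) x).flip w) x := by
      simpa using! hP.hasFDerivAt.clm_apply (hasFDerivAt_const w x)
    have h2 := hP.hasFDerivAt.clm_apply h1
    simp only [proj_proj] at h2
    have := DFunLike.congr_fun (h2.unique h1) v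
    simpa [add_comm] using this
  have h := congrArg (proj c x) (key (proj c x w))
  rw [proj_proj, map_add, proj_proj] at h
  simpa using h

/-- The normal part `N = W - P W` satisfies `N' = -P DP[v] W = -P DP[v] N`, because `P DP P = 0`. It
starts at zero and hence stays zero. -/
theorem mem_tangent_of_linear_ode (hT : IsTube c xs ε B) {g v W : ℝ → E d}
    (hgε : ∀ t ∈ Icc (0 : ℝ) 1, g t ∈ Metric.ball xs ε)
    (hg : ∀ t ∈ Icc (0 : ℝ) 1, HasDerivWithinAt g (v t) (Icc 0 1) t)
    (hv : ContinuousOn v (Icc 0 1))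
    (hW : ∀ t ∈ Icc (0 : ℝ) 1,
      HasDerivWithinAt W (fderiv ℝ (proj c) (g t) (v t) (W t)) (Icc 0 1) t)
    (h0 : W 0 ∈ tangent c (g 0)) : ∀ t ∈ Icc (0 : ℝ) 1, W t ∈ tangent c (g t) := by
  obtain ⟨K, hK⟩ := isCompact_Icc.exists_bound_of_continuousOn hv
  have hder : ∀ t ∈ Icc (0 : ℝ) 1, HasDerivWithinAt (fun t => W t - proj c (g t) (W t))
      (-proj c (g t) (fderiv ℝ (proj c) (g t) (v t) (W t))) (Icc 0 1) t := by
    intro t ht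
    have h1 : HasDerivWithinAt (fun s => proj c (g s)) (fderiv ℝ (proj c) (g t) (v t))
      (Icc 0 1) t := (hT.diff _ (hgε t ht)).hasFDerivAt.comp_hasDerivWithinAt t (hg t ht)
    convert! (hW t ht).sub (h1.clm_apply (hW t ht)) using 1
    abel
  have hz := eq_zero_of_abs_deriv_le_mul_abs_self_of_eq_zero_right (K := B * K)
    (fun t ht => (hder t ht).continuousWithinAt)
    (fun t ht => hasDerivWithinAt_Ici_of_Icc ht (hder t (Ico_subset_Icc_self ht)))
    (by rw [proj_eq_self_iff.mpr h0, sub_self]) (fun t ht => ?_)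
  · intro t ht
    rw [← proj_eq_self_iff]
    exact (sub_eq_zero.mp (hz t ht)).symm
  · have ht' := Ico_subset_Icc_self ht
    have hb := hgε t ht'
    have e : proj c (g t) (fderiv ℝ (proj c) (g t) (v t) (W t)) =
        proj c (g t) (fderiv ℝ (proj c) (g t) (v t) (W t - proj c (g t) (W t))) := by
      rw [map_sub, map_sub, proj_fderiv_proj (hT.diff _ hb), sub_zero]
    rw [norm_neg, e]
    refine (norm_proj_le _ _).trans ((hT.bound_apply hb _ _).trans ?_)
    have := hT.nonneg
    gcongr
    exact hK t ht'

/-- Converse to `IsParallel.derivWithin_eq`: tangency propagates along the ambient equations, and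
tangency of the velocity keeps each `c i` constant along the curve. -/
theorem isGeodesic_of_ode (hc : ∀ i, ContDiff ℝ ∞ (c i)) (hT : IsTube c xs ε B)
    {g v W : ℝ → E d} (hgε : ∀ t ∈ Icc (0 : ℝ) 1, g t ∈ Metric.ball xs ε)
    (hg : ∀ t ∈ Icc (0 : ℝ) 1, HasDerivWithinAt g (v t) (Icc 0 1) t)
    (hv : ∀ t ∈ Icc (0 : ℝ) 1,
      HasDerivWithinAt v (fderiv ℝ (proj c) (g t) (v t) (v t)) (Icc 0 1) t)
    (hW : ∀ t ∈ Icc (0 : ℝ) 1,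
      HasDerivWithinAt W (fderiv ℝ (proj c) (g t) (v t) (W t)) (Icc 0 1) t)
    (hg0 : g 0 ∈ feasible c) (hv0 : v 0 ∈ tangent c (g 0)) (hW0 : W 0 ∈ tangent c (g 0)) :
    IsGeodesic c g ∧ derivWithin g (Icc 0 1) 0 = v 0 ∧ IsParallel c g W := by
  have hU : UniqueDiffOn ℝ (Icc (0 : ℝ) 1) := uniqueDiffOn_Icc zero_lt_one
  have hgc : ContinuousOn g (Icc 0 1) := fun t ht => (hg t ht).continuousWithinAt
  have hvc : ContinuousOn v (Icc 0 1) := fun t ht => (hv t ht).continuousWithinAt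
  have hWc : ContinuousOn W (Icc 0 1) := fun t ht => (hW t ht).continuousWithinAt
  have hvT := mem_tangent_of_linear_ode hT hgε hg hvc hv hv0
  have hWT := mem_tangent_of_linear_ode hT hgε hg hvc hW hW0
  have hDc : ContinuousOn (fun t => fderiv ℝ (proj c) (g t) (v t)) (Icc 0 1) :=
    (hT.cont.comp hgc hgε).clm_apply hvc
  have dg : ∀ t ∈ Icc (0 : ℝ) 1, derivWithin g (Icc 0 1) t = v t := fun t ht =>
    (hg t ht).derivWithin (hU t ht)
  have smooth : ∀ {Z : ℝ → E d}, ContinuousOn Z (Icc 0 1) → (∀ t ∈ Icc (0 : ℝ) 1,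
      HasDerivWithinAt Z (fderiv ℝ (proj c) (g t) (v t) (Z t)) (Icc 0 1) t) →
      ContDiffOn ℝ 1 Z (Icc 0 1) := fun hZc hZ =>
    (contDiffOn_one_iff_derivWithin hU).mpr ⟨fun t ht => (hZ t ht).differentiableWithinAt,
      (hDc.clm_apply hZc).congr fun t ht => (hZ t ht).derivWithin (hU t ht)⟩
  have hcov : ∀ {Z : ℝ → E d}, (∀ t ∈ Icc (0 : ℝ) 1,
      HasDerivWithinAt Z (fderiv ℝ (proj c) (g t) (v t) (Z t)) (Icc 0 1) t) →
      (∀ t ∈ Icc (0 : ℝ) 1, Z t ∈ tangent c (g t)) →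
      ∀ t ∈ Icc (0 : ℝ) 1, covDeriv c g Z t = 0 := by
    intro Z hZ hZT t ht
    rw [covDeriv, (hZ t ht).derivWithin (hU t ht), ← proj_eq_self_iff.mpr (hZT t ht)]
    exact proj_fderiv_proj (hT.diff _ (hgε t ht)) _ _
  have hfeas : ∀ t ∈ Icc (0 : ℝ) 1, g t ∈ feasible c := by
    intro t ht i
    have hd : ∀ s ∈ Icc (0 : ℝ) 1, HasDerivWithinAt (fun s => c i (g s)) 0 (Icc 0 1) s := by
      intro s hs
      have h1 : HasDerivWithinAt (fun s => c i (g s)) (fderiv ℝ (c i) (g s) (v s)) (Icc 0 1) s :=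
        (((hc i).differentiable (by simp) (g s)).hasFDerivAt).comp_hasDerivWithinAt s (hg s hs)
      rwa [← inner_gradient_left, mem_tangent_iff.mp (hvT s hs) i] at h1
    have := constant_of_derivWithin_zero (fun s hs => (hd s hs).differentiableWithinAt)
      (fun s hs => (hd s (Ico_subset_Icc_self hs)).derivWithin (hU s (Ico_subset_Icc_self hs))) t ht
    rw [this]
    exact hg0 i
  refine ⟨⟨?_, hfeas, fun t ht => ?_⟩, dg 0 (left_mem_Icc.mpr zero_le_one),
    ⟨smooth hWc hW, hWT, hcov hW hWT⟩⟩
  · rw [show (2 : ℕ∞ω) = 1 + 1 by norm_num, contDiffOn_succ_iff_derivWithin hU]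
    exact ⟨fun t ht => (hg t ht).differentiableWithinAt, by simp, (smooth hvc hv).congr dg⟩
  · have := hcov hv hvT t ht
    rw [covDeriv] at this ⊢
    rwa [derivWithin_congr dg (dg t ht)]

theorem hasDerivWithinAt_fst {X Y : Type*} [NormedAddCommGroup X] [NormedSpace ℝ X]
    [NormedAddCommGroup Y] [NormedSpace ℝ Y] {f : ℝ → X × Y} {f' : X × Y} {s : Set ℝ} {t : ℝ}
    (h : HasDerivWithinAt f f' s t) : HasDerivWithinAt (fun t => (f t).1) f'.1 s t :=
  HasFDerivAt.comp_hasDerivWithinAt (l := Prod.fst) (l' := ContinuousLinearMap.fst ℝ X Y) t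
    (ContinuousLinearMap.fst ℝ X Y).hasFDerivAt h

theorem hasDerivWithinAt_snd {X Y : Type*} [NormedAddCommGroup X] [NormedSpace ℝ X]
    [NormedAddCommGroup Y] [NormedSpace ℝ Y] {f : ℝ → X × Y} {f' : X × Y} {s : Set ℝ} {t : ℝ}
    (h : HasDerivWithinAt f f' s t) : HasDerivWithinAt (fun t => (f t).2) f'.2 s t :=
  HasFDerivAt.comp_hasDerivWithinAt (l := Prod.snd) (l' := ContinuousLinearMap.snd ℝ X Y) t
    (ContinuousLinearMap.snd ℝ X Y).hasFDerivAt h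

/-- Geodesics with small initial velocity, and parallel fields along them, exist near `xs`. -/
theorem exists_geodesic_parallel (hc : ∀ i, ContDiff ℝ ∞ (c i))
    (hx : LinearIndependent ℝ (fun i => gradient (c i) xs)) :
    ∃ η > 0, ∀ x ∈ feasible c, ‖x - xs‖ < η → ∀ u ∈ tangent c x, ‖u‖ < η → ∀ w ∈ tangent c x,
      ∃ g W : ℝ → E d, IsGeodesic c g ∧ g 0 = x ∧ derivWithin g (Icc 0 1) 0 = u ∧
        IsParallel c g W ∧ W 0 = w := by
  obtain ⟨ε, B, hT⟩ := exists_isTube hc hx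
  -- State (position, velocity, transported vector): the geodesic equation coupled with the
  -- transport equation.
  set F : E d × E d × E d → E d × E d × E d := fun z =>
    (z.2.1, fderiv ℝ (proj c) z.1 z.2.1 z.2.1, fderiv ℝ (proj c) z.1 z.2.1 z.2.2) with hFdef
  have hF : ContDiffAt ℝ 1 F (xs, 0, 0) := by
    have hD : ContDiffAt ℝ 1 (fderiv ℝ (proj c)) xs :=
      (contDiffAt_proj hc hx).fderiv_right (m := 1) (by norm_cast)
    have h1 : ContDiffAt ℝ 1 (fun z : E d × E d × E d => fderiv ℝ (proj c) z.1) (xs, 0, 0) :=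
      hD.comp (xs, (0 : E d), (0 : E d)) contDiffAt_fst
    have h21 : ContDiffAt ℝ 1 (fun z : E d × E d × E d => z.2.1) (xs, 0, 0) := by fun_prop
    have h22 : ContDiffAt ℝ 1 (fun z : E d × E d × E d => z.2.2) (xs, 0, 0) := by fun_prop
    exact h21.prodMk (((h1.clm_apply h21).clm_apply h21).prodMk ((h1.clm_apply h21).clm_apply h22))
  obtain ⟨r, hr, τ, hτ, hflow⟩ := exists_local_flow_mem hF
    (U := Prod.fst ⁻¹' Metric.ball xs ε)
    (continuous_fst.continuousAt.preimage_mem_nhds (Metric.ball_mem_nhds _ hT.pos))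
  refine ⟨min r (τ * r), lt_min hr (mul_pos hτ hr), fun x hxf hxr u hu hur w hw => ?_⟩
  -- Transport is linear, so a `w` of any size is scaled into the flow's ball and scaled back
  -- afterwards. The velocity `τ⁻¹ • u` compensates for running the flow only up to time `τ`.
  set l : ℝ := r / (2 * (‖w‖ + 1)) with hl
  have hw1 : 0 < ‖w‖ + 1 := by positivity
  have hl0 : 0 < l := by positivity
  obtain ⟨α, hα0, hα⟩ := hflow (x, τ⁻¹ • u, l • w) (by
    rw [mem_ball_iff_norm]
    simp only [Prod.mk_sub_mk, sub_zero, Prod.norm_mk]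
    refine max_lt (hxr.trans_le (min_le_left _ _)) (max_lt ?_ ?_)
    · rw [norm_smul, norm_inv, Real.norm_of_nonneg hτ.le, inv_mul_lt_iff₀ hτ]
      exact hur.trans_le (min_le_right _ _)
    · rw [norm_smul, Real.norm_of_nonneg hl0.le, hl, div_mul_eq_mul_div,
        div_lt_iff₀ (by positivity)]
      nlinarith [norm_nonneg w])
  have hmaps : ∀ t ∈ Icc (0 : ℝ) 1, τ * t ∈ Icc (0 : ℝ) τ := fun t ht =>
    ⟨mul_nonneg hτ.le ht.1, mul_le_of_le_one_right hτ.le ht.2⟩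
  have hder : ∀ t ∈ Icc (0 : ℝ) 1,
      HasDerivWithinAt (fun t => α (τ * t)) (τ • F (α (τ * t))) (Icc 0 1) t := by
    intro t ht
    have h1 : HasDerivWithinAt (fun t : ℝ => τ * t) τ (Icc 0 1) t := by
      simpa using (hasDerivWithinAt_id t (Icc 0 1)).const_mul τ
    exact ((hα _ (hmaps t ht)).2).scomp t h1 hmaps
  have h1 : ∀ t ∈ Icc (0 : ℝ) 1,
      HasDerivWithinAt (fun t => (α (τ * t)).1) (τ • (α (τ * t)).2.1) (Icc 0 1) t :=
    fun t ht => hasDerivWithinAt_fst (hder t ht)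
  have h2 : ∀ t ∈ Icc (0 : ℝ) 1,
      HasDerivWithinAt (fun t => (α (τ * t)).2) (τ • (F (α (τ * t))).2) (Icc 0 1) t :=
    fun t ht => hasDerivWithinAt_snd (hder t ht)
  have h21 : ∀ t ∈ Icc (0 : ℝ) 1,
      HasDerivWithinAt (fun t => (α (τ * t)).2.1) (τ • (F (α (τ * t))).2.1) (Icc 0 1) t :=
    fun t ht => hasDerivWithinAt_fst (h2 t ht)
  have h22 : ∀ t ∈ Icc (0 : ℝ) 1,
      HasDerivWithinAt (fun t => (α (τ * t)).2.2) (τ • (F (α (τ * t))).2.2) (Icc 0 1) t :=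
    fun t ht => hasDerivWithinAt_snd (h2 t ht)
  have hg0 : (α (τ * 0)).1 = x := by rw [mul_zero, hα0]
  have hv0 : τ • (α (τ * 0)).2.1 = u := by
    rw [mul_zero, hα0]; exact smul_inv_smul₀ hτ.ne' u
  have hW0 : l⁻¹ • (α (τ * 0)).2.2 = w := by
    rw [mul_zero, hα0]; exact inv_smul_smul₀ hl0.ne' w
  have hres := isGeodesic_of_ode hc hT (g := fun t => (α (τ * t)).1)
    (v := fun t => τ • (α (τ * t)).2.1) (W := fun t => l⁻¹ • (α (τ * t)).2.2)
    (fun t ht => (hα _ (hmaps t ht)).1) h1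
    (fun t ht => by simpa [hFdef] using (h21 t ht).fun_const_smul τ)
    (fun t ht => by simpa [hFdef, smul_comm τ l⁻¹] using (h22 t ht).fun_const_smul l⁻¹)
    (by simpa only [hg0] using hxf) (by simpa only [hg0, hv0] using hu)
    (by simpa only [hg0, hW0] using hw)
  exact ⟨_, _, hres.1, hg0, hres.2.1.trans hv0, hres.2.2, hW0⟩

end ExpExistence

/-! ### Reversal, uniqueness and local surjectivity of the exponential map. -/

section Coordinates

open scoped Pointwise

variable {c : Fin m → E d → ℝ} {xs : E d} {ε B : ℝ} {g V W : ℝ → E d} {t : ℝ}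

theorem one_sub_mem_unitInterval (ht : t ∈ Icc (0 : ℝ) 1) : 1 - t ∈ Icc (0 : ℝ) 1 :=
  ⟨by linarith [ht.2], by linarith [ht.1]⟩

theorem derivWithin_comp_one_sub (f : ℝ → E d) :
    derivWithin (fun t => f (1 - t)) (Icc (0 : ℝ) 1) =
      fun t => -derivWithin f (Icc (0 : ℝ) 1) (1 - t) := by
  have h : (1 : ℝ) +ᵥ -Icc (0 : ℝ) 1 = Icc (0 : ℝ) 1 := by
    ext x
    simp only [mem_vadd_set, Set.mem_neg, vadd_eq_add, mem_Icc]
    constructor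
    · rintro ⟨y, hy, rfl⟩
      exact ⟨by linarith [hy.2], by linarith [hy.1]⟩
    · intro hx
      exact ⟨x - 1, ⟨by linarith [hx.2], by linarith [hx.1]⟩, by ring⟩
  funext t
  rw [derivWithin_comp_const_sub, h]

theorem contDiffOn_comp_one_sub {n : WithTop ℕ∞} {f : ℝ → E d} (hf : ContDiffOn ℝ n f (Icc 0 1)) :
    ContDiffOn ℝ n (fun t => f (1 - t)) (Icc (0 : ℝ) 1) :=
  hf.comp (contDiffOn_const.sub contDiffOn_id) fun _ ht => one_sub_mem_unitInterval ht

theorem IsGeodesic.reverse (hg : IsGeodesic c g) : IsGeodesic c fun t => g (1 - t) where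
  smooth := contDiffOn_comp_one_sub hg.smooth
  feasible t ht := hg.feasible _ (one_sub_mem_unitInterval ht)
  geodesic t ht := by
    have h := hg.geodesic _ (one_sub_mem_unitInterval ht)
    rw [covDeriv, derivWithin_comp_one_sub, derivWithin.fun_neg, derivWithin_comp_one_sub, neg_neg]
    exact h

theorem IsParallel.reverse (hV : IsParallel c g V) :
    IsParallel c (fun t => g (1 - t)) fun t => V (1 - t) where
  smooth := contDiffOn_comp_one_sub hV.smooth
  tangent t ht := hV.tangent _ (one_sub_mem_unitInterval ht)
  parallel t ht := by
    have h := hV.parallel _ (one_sub_mem_unitInterval ht)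
    rw [covDeriv, derivWithin_comp_one_sub, map_neg, neg_eq_zero]
    exact h

theorem IsParallel.congr_curve {g' : ℝ → E d} (hV : IsParallel c g V)
    (h : ∀ t ∈ Icc (0 : ℝ) 1, g t = g' t) : IsParallel c g' V where
  smooth := hV.smooth
  tangent t ht := h t ht ▸ hV.tangent t ht
  parallel t ht := by
    have := hV.parallel t ht
    rwa [covDeriv, h t ht] at this

theorem IsParallel.sub (hV : IsParallel c g V) (hW : IsParallel c g W) :
    IsParallel c g fun t => V t - W t where
  smooth := hV.smooth.sub hW.smooth
  tangent t ht := Submodule.sub_mem _ (hV.tangent t ht) (hW.tangent t ht)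
  parallel t ht := by
    have h1 := hV.parallel t ht
    have h2 := hW.parallel t ht
    rw [covDeriv] at h1 h2
    rw [covDeriv, ((hV.hasDerivWithinAt ht).fun_sub (hW.hasDerivWithinAt ht)).derivWithin
      (uniqueDiffWithinAt_unitInterval ht), map_sub, h1, h2, sub_zero]

/-- The difference of two parallel fields is parallel, hence of constant norm: transport is
injective in both directions. -/
theorem IsParallel.eq_iff (hV : IsParallel c g V) (hW : IsParallel c g W) :
    V 1 = W 1 ↔ V 0 = W 0 := by
  have := (hV.sub hW).norm_eq (right_mem_Icc.mpr zero_le_one)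
  rw [← sub_eq_zero, ← norm_eq_zero, this, norm_eq_zero, sub_eq_zero]

theorem IsGeodesic.eqOn (hc : ∀ i, ContDiff ℝ ∞ (c i)) (hT : IsTube c xs ε B)
    {g₁ g₂ : ℝ → E d} (hg₁ : IsGeodesic c g₁) (hg₂ : IsGeodesic c g₂) (h0 : g₁ 0 = g₂ 0)
    (hu : derivWithin g₁ (Icc 0 1) 0 = derivWithin g₂ (Icc 0 1) 0)
    (hε : ‖g₁ 0 - xs‖ + ‖derivWithin g₁ (Icc 0 1) 0‖ < ε)
    (h1 : ‖derivWithin g₁ (Icc 0 1) 0‖ ≤ 1) : ∀ t ∈ Icc (0 : ℝ) 1, g₁ t = g₂ t := by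
  intro t ht
  have h := hg₁.norm_sub_sub_smul_le hc hT hg₂ (hg₁.mapsTo_ball hc hε)
    (hg₂.mapsTo_ball hc (by rwa [← h0, ← hu])) h0 le_rfl h1 (by rwa [← hu]) ht
  rw [hu, sub_self, norm_zero, mul_zero, smul_zero, sub_zero] at h
  exact sub_eq_zero.mp (norm_le_zero_iff.mp h)

theorem enorm_sub_le_geodesicDist (x y : E d) : ‖x - y‖ₑ ≤ geodesicDist c x y := by
  refine le_iInf₂ fun g hg => ?_
  have h := enorm_sub_le_lintegral_derivWithin_Icc_of_contDiffOn_Icc hg.1 zero_le_one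
  rw [hg.2.2.1, hg.2.2.2] at h
  rwa [← enorm_neg, neg_sub]

/-- The reversed geodesic competes in the infimum, and its constant speed makes its length that of
the initial velocity. Minimality of geodesics plays no role. -/
theorem IsGeodesic.geodesicDist_le (hc : ∀ i, ContDiff ℝ ∞ (c i)) (hg : IsGeodesic c g) :
    geodesicDist c (g 1) (g 0) ≤ ‖derivWithin g (Icc 0 1) 0‖ₑ := by
  refine (iInf₂_le (fun t => g (1 - t)) ⟨hg.reverse.smooth.of_le (by norm_num),
    hg.reverse.feasible, by simp, by simp⟩).trans ?_
  rw [setLIntegral_congr_fun (g := fun _ => ‖derivWithin g (Icc 0 1) 0‖ₑ) measurableSet_Icc]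
  · simp
  · intro t ht
    rw [derivWithin_comp_one_sub]
    simp only [enorm_neg]
    rw [enorm_eq_iff_norm_eq]
    exact (hg.isParallel hc).norm_eq (one_sub_mem_unitInterval ht)

/-- Near `xs` the derivative of the constraint map controls differences of points along the normal
space, so that two nearby feasible points do not differ by a normal vector. -/
theorem exists_normal_injective (hc : ∀ i, ContDiff ℝ ∞ (c i)) (xs : E d) :
    ∃ ρ > 0, ∀ x ∈ feasible c, ∀ y ∈ feasible c, x ∈ Metric.ball xs ρ → y ∈ Metric.ball xs ρ →
      x - y ∈ (tangent c xs)ᗮ → x = y := by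
  set w : Fin m → E d := fun i => gradient (c i) xs
  have hstrict : HasStrictFDerivAt (fun x i => c i x) (analysis w) xs := by
    rw [hasStrictFDerivAt_pi']
    intro i
    convert (hc i).contDiffAt.hasStrictFDerivAt (x := xs) (by simp) using 1
    ext v
    simp [w, inner_gradient_left]
  have hker : LinearMap.ker ((analysis w).toLinearMap ∘ₗ (tangent c xs)ᗮ.subtype) = ⊥ := by
    rw [LinearMap.ker_eq_bot']
    rintro ⟨n, hn⟩ h
    have hnT : n ∈ tangent c xs := mem_tangent_iff.mpr fun i => by
      simpa [w] using congrFun h i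
    have := (Submodule.mem_orthogonal _ _).mp hn n hnT
    exact Subtype.ext (inner_self_eq_zero.mp this)
  obtain ⟨K, hK, hanti⟩ := LinearMap.exists_antilipschitzWith _ hker
  have hK' : (0 : ℝ) < K := hK
  -- On normal vectors the derivative expands by at least `1/K`; a linearisation error of relative
  -- size `1/(2K)` leaves half of this, which forces equal constraint values to come from equal
  -- points.
  have hlo := hstrict.isLittleO.def (c := (2 * K : ℝ)⁻¹) (by positivity)
  rw [nhds_prod_eq] at hlo
  obtain ⟨ρ, hρ, hb⟩ := Metric.eventually_nhds_iff_ball.mp (nhds_prod_eq (x := xs) (y := xs) ▸ hlo)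
  refine ⟨ρ, hρ, fun x hx y hy hxb hyb hn => ?_⟩
  have h1 := hb (x, y) (by rw [← ball_prod_same]; exact ⟨hxb, hyb⟩)
  have hx0 : (fun i => c i x) = 0 := funext hx
  have hy0 : (fun i => c i y) = 0 := funext hy
  simp only [hx0, hy0, sub_self, zero_sub, norm_neg] at h1
  have h2 := hanti.le_mul_dist (⟨x - y, hn⟩ : (tangent c xs)ᗮ) 0
  rw [dist_zero_right, map_zero, dist_zero_right] at h2
  have h3 : ‖x - y‖ ≤ K * ‖analysis w (x - y)‖ := h2
  have h4 : K * ‖analysis w (x - y)‖ ≤ K * ((2 * K : ℝ)⁻¹ * ‖x - y‖) := by gcongr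
  have h5 : K * ((2 * K : ℝ)⁻¹ * ‖x - y‖) = ‖x - y‖ / 2 := by field_simp
  have h6 : ‖x - y‖ ≤ 0 := by linarith
  exact sub_eq_zero.mp (norm_le_zero_iff.mp h6)

/-- Every feasible point close to `xs` is joined to `xs` by a short geodesic. -/
theorem eventually_exists_geodesic (hc : ∀ i, ContDiff ℝ ∞ (c i)) (hxs : xs ∈ feasible c)
    (hx : LinearIndependent ℝ (fun i => gradient (c i) xs)) {η : ℝ} (hη : 0 < η) :
    ∀ᶠ x in 𝓝 xs, x ∈ feasible c → ∃ g, IsGeodesic c g ∧ g 0 = xs ∧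
      ‖derivWithin g (Icc 0 1) 0‖ < η ∧ g 1 = x := by
  obtain ⟨ε, B, hT⟩ := exists_isTube hc hx
  obtain ⟨η₀, hη₀, hex⟩ := exists_geodesic_parallel hc hx
  obtain ⟨ρ₁, hρ₁, hnorm⟩ := exists_normal_injective hc xs
  have hex' : ∀ u ∈ tangent c xs, ‖u‖ < η₀ → ∃ g, IsGeodesic c g ∧ g 0 = xs ∧
      derivWithin g (Icc 0 1) 0 = u := fun u hu hlt => by
    obtain ⟨g, W, h1, h2, h3, -⟩ := hex xs hxs (by simpa using hη₀) u hu hlt 0 (zero_mem _)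
    exact ⟨g, h1, h2, h3⟩
  choose! g hg hg0 hgu using hex'
  set C := 3 * B * Real.exp (1 + 3 * B)
  have hB := hT.nonneg
  have hC : 0 ≤ C := by positivity
  set ρ := min (min (min η η₀) (min ε ρ₁)) (min 1 (1 / (2 * (C + 1))))
  have hρ : 0 < ρ := lt_min (lt_min (lt_min hη hη₀) (lt_min hT.pos hρ₁)) (lt_min one_pos (by positivity))
  have hρη : ρ ≤ η := ((min_le_left _ _).trans (min_le_left _ _)).trans (min_le_left _ _)
  have hρη₀ : ρ ≤ η₀ := ((min_le_left _ _).trans (min_le_left _ _)).trans (min_le_right _ _)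
  have hρε : ρ ≤ ε := ((min_le_left _ _).trans (min_le_right _ _)).trans (min_le_left _ _)
  have hρρ₁ : ρ ≤ ρ₁ := ((min_le_left _ _).trans (min_le_right _ _)).trans (min_le_right _ _)
  have hρ1 : ρ ≤ 1 := (min_le_right _ _).trans (min_le_left _ _)
  have hCρ : C * ρ ≤ 1 / 2 := by
    have h : ρ ≤ 1 / (2 * (C + 1)) := (min_le_right _ _).trans (min_le_right _ _)
    calc C * ρ ≤ (C + 1) * (1 / (2 * (C + 1))) := by gcongr; linarith
      _ = 1 / 2 := by field_simp
  set P := proj c xs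
  have hP : ∀ y ∈ Metric.ball (0 : E d) ρ, P y ∈ tangent c xs ∧ ‖P y‖ < ρ := fun y hy =>
    ⟨proj_mem _ _, (norm_proj_le _ _).trans_lt (mem_ball_zero_iff.mp hy)⟩
  have hball : ∀ y ∈ Metric.ball (0 : E d) ρ, ∀ t ∈ Icc (0 : ℝ) 1,
      g (P y) t ∈ Metric.ball xs ρ := by
    intro y hy
    have h := hP y hy
    refine (hg _ h.1 (h.2.trans_le hρη₀)).mapsTo_ball hc ?_
    rw [hg0 _ h.1 (h.2.trans_le hρη₀), hgu _ h.1 (h.2.trans_le hρη₀), sub_self, norm_zero, zero_add]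
    exact h.2
  -- `exp` is extended by the identity in the normal directions, `y ↦ exp(P y) + (y - P y)`. This
  -- map of the whole space differs from the identity by a Lipschitz map of constant `1/2`, so its
  -- image is a neighbourhood of `xs`, without differentiating `exp`.
  have happrox : ApproximatesLinearOn (fun y => g (P y) 1 + (y - P y))
      ((ContinuousLinearEquiv.refl ℝ (E d) : E d ≃L[ℝ] E d) : E d →L[ℝ] E d)
      (Metric.ball 0 ρ) (1 / 2) := by
    intro y hy z hz
    have hy' := hP y hy
    have hz' := hP z hz
    have h := (hg _ hy'.1 (hy'.2.trans_le hρη₀)).norm_sub_sub_smul_le hc hT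
      (hg _ hz'.1 (hz'.2.trans_le hρη₀))
      (fun t ht => Metric.ball_subset_ball hρε (hball y hy t ht))
      (fun t ht => Metric.ball_subset_ball hρε (hball z hz t ht))
      (by rw [hg0 _ hy'.1 (hy'.2.trans_le hρη₀), hg0 _ hz'.1 (hz'.2.trans_le hρη₀)]) hρ1
      (by rw [hgu _ hy'.1 (hy'.2.trans_le hρη₀)]; exact hy'.2.le)
      (by rw [hgu _ hz'.1 (hz'.2.trans_le hρη₀)]; exact hz'.2.le) (right_mem_Icc.mpr zero_le_one)
    rw [hgu _ hy'.1 (hy'.2.trans_le hρη₀), hgu _ hz'.1 (hz'.2.trans_le hρη₀), one_smul,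
      ← map_sub] at h
    have e : g (P y) 1 + (y - P y) - (g (P z) 1 + (z - P z)) -
        ((ContinuousLinearEquiv.refl ℝ (E d) : E d ≃L[ℝ] E d) : E d →L[ℝ] E d) (y - z) =
        g (P y) 1 - g (P z) 1 - P (y - z) := by
      simp only [ContinuousLinearEquiv.coe_refl, ContinuousLinearMap.id_apply, map_sub]
      abel
    rw [e]
    refine h.trans ?_
    have : ((1 / 2 : NNReal) : ℝ) = 1 / 2 := by norm_num
    rw [this]
    have h2 : ‖P (y - z)‖ ≤ ‖y - z‖ := norm_proj_le _ _
    exact mul_le_mul hCρ h2 (norm_nonneg _) (by norm_num)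
  have himg : (fun y => g (P y) 1 + (y - P y)) '' Metric.ball 0 ρ ∈ 𝓝 (g (P 0) 1 + (0 - P 0)) := by
    -- The inverse of the identity has norm one only in a nontrivial space.
    rcases subsingleton_or_nontrivial (E d) with hs | hn
    · rw [show (fun y => g (P y) 1 + (y - P y)) '' Metric.ball 0 ρ = univ from ?_]
      · exact univ_mem
      · exact Subsingleton.eq_univ_of_nonempty ⟨_, 0, Metric.mem_ball_self hρ, rfl⟩
    · refine happrox.image_mem_nhds
        (ContinuousLinearEquiv.refl ℝ (E d)).toNonlinearRightInverse (Metric.ball_mem_nhds _ hρ)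
        (Or.inr ?_)
      have h1 : (ContinuousLinearEquiv.refl ℝ (E d)).toNonlinearRightInverse.nnnorm = 1 := by
        change ‖((ContinuousLinearEquiv.refl ℝ (E d)).symm : E d →L[ℝ] E d)‖₊ = 1
        simp
      rw [h1]
      norm_num
  have h0 : g (P 0) 1 + (0 - P 0) = xs := by
    have hm := hP 0 (Metric.mem_ball_self hρ)
    rw [map_zero] at hm ⊢
    have := (hg _ hm.1 (hm.2.trans_le hρη₀)).norm_sub_le hc (right_mem_Icc.mpr zero_le_one)
    rw [hg0 _ hm.1 (hm.2.trans_le hρη₀), hgu _ hm.1 (hm.2.trans_le hρη₀), norm_zero] at this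
    rw [sub_zero, add_zero]
    exact sub_eq_zero.mp (norm_le_zero_iff.mp this)
  rw [h0] at himg
  filter_upwards [himg, Metric.ball_mem_nhds xs hρ₁] with x hxi hxb hxf
  obtain ⟨y, hy, rfl⟩ := hxi
  have hy' := hP y hy
  have hgy := hg _ hy'.1 (hy'.2.trans_le hρη₀)
  have h01 : (1 : ℝ) ∈ Icc (0 : ℝ) 1 := right_mem_Icc.mpr zero_le_one
  refine ⟨g (P y), hgy, hg0 _ hy'.1 (hy'.2.trans_le hρη₀), ?_, ?_⟩
  · rw [hgu _ hy'.1 (hy'.2.trans_le hρη₀)]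
    exact hy'.2.trans_le hρη
  -- The feasible points `x` and `exp(P y)` differ by the normal vector `y - P y`, so they coincide.
  · refine (hnorm _ hxf _ (hgy.feasible 1 h01) hxb
      (Metric.ball_subset_ball hρρ₁ (hball y hy 1 h01)) ?_).symm
    have e : g (P y) 1 + (y - P y) - g (P y) 1 = y - P y := by abel
    simp only [e]
    exact Submodule.sub_starProjection_mem_orthogonal y

end Coordinates

/-! ### The coordinates at the saddle are well defined. -/

section CoordinatesWellDefined

variable {c : Fin m → E d → ℝ} {xs : E d} {ε B : ℝ} {g V W : ℝ → E d} {t : ℝ}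

/-- Fields are constructed from their initial value, whereas here the value `w` is given at the far
end. The field is therefore built along the geodesic from `x` with velocity `-g'(1)`, which is `g`
reversed by uniqueness, and then reversed. -/
theorem exists_coord (hc : ∀ i, ContDiff ℝ ∞ (c i)) (hxs : xs ∈ feasible c)
    (hx : LinearIndependent ℝ (fun i => gradient (c i) xs)) {r : ℝ} (hr : 0 < r) :
    ∃ ρ > 0, ∀ x ∈ feasible c, ‖x - xs‖ < ρ → ∀ w ∈ tangent c x, ∃ p, IsCoord c xs r x w p := by
  obtain ⟨ε, B, hT⟩ := exists_isTube hc hx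
  obtain ⟨η₀, hη₀, hex⟩ := exists_geodesic_parallel hc hx
  set η := min (min r η₀) (min (ε / 2) 1)
  have hη : 0 < η := lt_min (lt_min hr hη₀) (lt_min (half_pos hT.pos) one_pos)
  obtain ⟨ρ, hρ, hgeo⟩ := Metric.eventually_nhds_iff_ball.mp
    (eventually_exists_geodesic hc hxs hx hη)
  refine ⟨min ρ (min η₀ (ε / 2)), lt_min hρ (lt_min hη₀ (half_pos hT.pos)),
    fun x hxf hxρ w hw => ?_⟩
  obtain ⟨g, hg, hg0, hgu, rfl⟩ := hgeo x
    (mem_ball_iff_norm.mpr (hxρ.trans_le (min_le_left _ _))) hxf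
  have h0 : (0 : ℝ) ∈ Icc (0 : ℝ) 1 := left_mem_Icc.mpr zero_le_one
  have h1 : (1 : ℝ) ∈ Icc (0 : ℝ) 1 := right_mem_Icc.mpr zero_le_one
  have hp := hg.isParallel hc
  have hu : -derivWithin g (Icc 0 1) 1 ∈ tangent c (g 1) := neg_mem (hp.tangent 1 h1)
  have hun : ‖-derivWithin g (Icc 0 1) 1‖ < η := by rwa [norm_neg, hp.norm_eq h1]
  obtain ⟨h, W, hh, hh0, hhu, hW, hW0⟩ := hex (g 1) hxf
    (hxρ.trans_le ((min_le_right _ _).trans (min_le_left _ _))) _ hu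
    (hun.trans_le ((min_le_left _ _).trans (min_le_right _ _))) w hw
  have hrev : ∀ t ∈ Icc (0 : ℝ) 1, h t = g (1 - t) := by
    refine hh.eqOn hc hT hg.reverse (by simp [hh0]) ?_ ?_ ?_
    · simp [hhu, derivWithin_comp_one_sub]
    · rw [hh0, hhu]
      have h3 : ‖g 1 - xs‖ < ε / 2 := hxρ.trans_le ((min_le_right _ _).trans (min_le_right _ _))
      have h4 : ‖-derivWithin g (Icc 0 1) 1‖ < ε / 2 :=
        hun.trans_le ((min_le_right _ _).trans (min_le_left _ _))
      linarith
    · rw [hhu]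
      exact hun.le.trans ((min_le_right _ _).trans (min_le_right _ _))
  have hV : IsParallel c g fun t => W (1 - t) := by
    refine hW.reverse.congr_curve fun t ht => ?_
    rw [hrev _ (one_sub_mem_unitInterval ht), sub_sub_cancel]
  refine ⟨(derivWithin g (Icc 0 1) 0, W 1), ?_, ?_,
    hgu.trans_le ((min_le_left _ _).trans (min_le_left _ _)),
    g, fun t => W (1 - t), hg, hg0, rfl, rfl, hV, by simp, by simpa using hW0⟩
  · exact hg0 ▸ hp.tangent 0 h0
  · have := hV.tangent 0 h0
    rwa [sub_zero, hg0] at this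

theorem exists_coordsWellDefined (hc : ∀ i, ContDiff ℝ ∞ (c i)) (hxs : xs ∈ feasible c)
    (hx : LinearIndependent ℝ (fun i => gradient (c i) xs)) :
    ∃ r₀ > 0, ∀ r, 0 < r → r ≤ r₀ → ∀ δ, r ≤ δ → ∃ r1 > 0, CoordsWellDefined c xs r r1 δ := by
  obtain ⟨ε, B, hT⟩ := exists_isTube hc hx
  obtain ⟨η₀, hη₀, hex⟩ := exists_geodesic_parallel hc hx
  set C := 3 * B * Real.exp (1 + 3 * B)
  have hB := hT.nonneg
  have hC : 0 ≤ C := by positivity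
  refine ⟨min (min η₀ ε) (min 1 (1 / (C + 1))),
    lt_min (lt_min hη₀ hT.pos) (lt_min one_pos (by positivity)), fun r hr hrr δ hδ => ?_⟩
  have hrη : r ≤ η₀ := (hrr.trans (min_le_left _ _)).trans (min_le_left _ _)
  have hrε : r ≤ ε := (hrr.trans (min_le_left _ _)).trans (min_le_right _ _)
  have hr1 : r ≤ 1 := (hrr.trans (min_le_right _ _)).trans (min_le_left _ _)
  have hrC : C * r < 1 := by
    have h : r ≤ 1 / (C + 1) := (hrr.trans (min_le_right _ _)).trans (min_le_right _ _)
    rw [le_div_iff₀ (by positivity)] at h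
    linarith
  obtain ⟨r1, hr1', hcoord⟩ := exists_coord hc hxs hx hr
  have hball : ∀ g : ℝ → E d, IsGeodesic c g → g 0 = xs → ‖derivWithin g (Icc 0 1) 0‖ < r →
      ‖g 0 - xs‖ + ‖derivWithin g (Icc 0 1) 0‖ < ε := by
    intro g hg h0 hu
    rw [h0, sub_self, norm_zero, zero_add]
    exact hu.trans_le hrε
  refine ⟨r1, hr1', ⟨?_, fun x hxf hd w hw => hcoord x hxf ?_ w hw, ?_, ?_⟩⟩
  · rintro x w ⟨u, ρ⟩ ⟨u', ρ'⟩ ⟨hu, hρ, hur, g, V, hg, hg0, hgu, hg1, hV, hV0, hV1⟩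
      ⟨hu', hρ', hur', g', V', hg', hg0', hgu', hg1', hV', hV0', hV1'⟩
    dsimp only at hu hρ hur hgu hV0 hu' hρ' hur' hgu' hV0'
    have h := hg.norm_sub_sub_smul_le hc hT hg'
      (hg.mapsTo_ball hc (hball g hg hg0 (hgu ▸ hur)))
      (hg'.mapsTo_ball hc (hball g' hg' hg0' (hgu' ▸ hur'))) (hg0.trans hg0'.symm) hr1
      (hgu ▸ hur.le) (hgu' ▸ hur'.le) (right_mem_Icc.mpr zero_le_one)
    rw [hg1, hg1', sub_self, zero_sub, one_smul, norm_neg, hgu, hgu'] at h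
    -- Equal endpoints give `‖u - u'‖ ≤ C s ‖u - u'‖` with `s = r`, and `C r < 1`.
    have hz : ‖u - u'‖ ≤ 0 := by
      by_contra hcon
      push Not at hcon
      nlinarith
    have huu : u = u' := sub_eq_zero.mp (norm_le_zero_iff.mp hz)
    have heq := hg.eqOn hc hT hg' (hg0.trans hg0'.symm) (by rw [hgu, hgu', huu])
      (hball g hg hg0 (hgu ▸ hur)) (by rw [hgu]; exact hur.le.trans hr1)
    have := (hV.congr_curve heq).eq_iff hV'
    rw [huu, ← hV0, ← hV0', this.mp (by rw [hV1, hV1'])]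
  · have h := (enorm_sub_le_geodesicDist x xs).trans_lt hd
    rw [← ofReal_norm] at h
    exact (ENNReal.ofReal_lt_ofReal_iff hr1').mp h
  · rintro ⟨u, ρ⟩ hu hρ hur
    dsimp only at hu hρ hur
    obtain ⟨g, V, hg, hg0, hgu, hV, hV0⟩ := hex xs hxs (by simpa using hη₀) u hu
      (hur.trans_le hrη) ρ hρ
    refine ⟨(g 1, V 1), ⟨hu, hρ, hur, g, V, hg, hg0, hgu, rfl, hV, hV0, rfl⟩, ?_⟩
    rintro ⟨y, z⟩ ⟨-, -, -, g', V', hg', hg0', hgu', hg1', hV', hV0', hV1'⟩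
    dsimp only at hgu' hV0' hg1' hV1'
    have heq := hg.eqOn hc hT hg' (hg0.trans hg0'.symm) (by rw [hgu, hgu'])
      (hball g hg hg0 (hgu ▸ hur)) (by rw [hgu]; exact hur.le.trans hr1)
    have := (hV.congr_curve heq).eq_iff hV'
    rw [this.mpr (by rw [hV0, hV0']), heq 1 (right_mem_Icc.mpr zero_le_one), hg1', hV1']
  · rintro x w ⟨u, ρ⟩ ⟨hu, hρ, hur, g, V, hg, hg0, hgu, rfl, hV, hV0, rfl⟩
    dsimp only at hu hρ hur hgu hV0
    have h1 := right_mem_Icc.mpr (zero_le_one (α := ℝ))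
    refine ⟨hg.feasible 1 h1, ?_, hV.tangent 1 h1⟩
    have := hg.geodesicDist_le hc
    rw [hg0, hgu] at this
    refine this.trans_lt ?_
    rw [← ofReal_norm]
    exact (ENNReal.ofReal_lt_ofReal_iff (hr.trans_le hδ)).mpr (hur.trans_le hδ)

end CoordinatesWellDefined

/-! ### Stability of the unstable eigenspace and independence of the eigenbasis. -/

section SpectralFrames

/-- The orthogonal projector `∑ v_i v_iᵀ` onto the span of an orthonormal family. -/
noncomputable def frameProj (v : Fin k → E d) : E d →L[ℝ] E d :=
  ∑ i, (innerSL ℝ (v i)).smulRight (v i)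

theorem frameProj_apply (v : Fin k → E d) (y : E d) :
    frameProj v y = ∑ i, inner ℝ (v i) y • v i := by
  simp [frameProj]

theorem householder_apply (v : Fin k → E d) (y : E d) :
    householder v y = y - (2 : ℝ) • frameProj v y := rfl

theorem inner_frameProj_left (v : Fin k → E d) (x y : E d) :
    inner ℝ (frameProj v x) y = inner ℝ x (frameProj v y) := by
  simp only [frameProj_apply, sum_inner, inner_sum, real_inner_smul_left, real_inner_smul_right]
  refine Finset.sum_congr rfl fun i _ => ?_
  rw [real_inner_comm (v i) x]
  ring

theorem inner_frameProj {v : Fin k → E d} (hv : Orthonormal ℝ v) (i : Fin k) (y : E d) :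
    inner ℝ (v i) (frameProj v y) = inner ℝ (v i) y := by
  rw [frameProj_apply]
  exact hv.inner_right_fintype _ i

theorem norm_frameProj_le {v : Fin k → E d} (hv : Orthonormal ℝ v) (y : E d) :
    ‖frameProj v y‖ ≤ k * ‖y‖ := by
  rw [frameProj_apply]
  refine (norm_sum_le_of_le _ (n := fun _ => ‖y‖) fun i _ => ?_).trans_eq (by simp)
  rw [norm_smul, hv.1 i, mul_one]
  exact (norm_inner_le_norm _ _).trans_eq (by rw [hv.1 i, one_mul])

theorem norm_householder_le {v : Fin k → E d} (hv : Orthonormal ℝ v) (y : E d) :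
    ‖householder v y‖ ≤ (1 + 2 * k) * ‖y‖ := by
  rw [householder_apply]
  refine (norm_sub_le _ _).trans ?_
  rw [norm_smul, Real.norm_ofNat]
  linarith [norm_frameProj_le hv y]

/-- `v` is an orthonormal family of eigenvectors of `M` with eigenvalues at most `-μ`, and `M` is
nonnegative on the orthogonal complement. -/
structure IsNegFrame (M : E d →L[ℝ] E d) (v : Fin k → E d) (μ : ℝ) : Prop where
  orthonormal : Orthonormal ℝ v
  eigen : ∀ i, ∃ a ≤ -μ, M (v i) = a • v i
  nonneg : ∀ z, (∀ i, inner ℝ (v i) z = 0) → 0 ≤ inner ℝ z (M z)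

variable {M M' : E d →L[ℝ] E d} {v v' : Fin k → E d} {μ : ℝ}

/-- Let `z` be the part of `v i` orthogonal to the frame `v'`. As `M'` preserves the span of `v'`,
`⟪z, M' (v i)⟫ = ⟪z, M' z⟫ ≥ 0`, while `⟪z, M (v i)⟫ ≤ -μ ‖z‖²`. Subtracting, `μ ‖z‖² ≤ ‖z‖ ‖M -
M'‖`. Neither operator has to be symmetric. -/
theorem IsNegFrame.norm_sub_frameProj_le (hμ : 0 < μ) (h : IsNegFrame M v μ)
    (h' : IsNegFrame M' v' μ) (i : Fin k) :
    ‖v i - frameProj v' (v i)‖ ≤ ‖M - M'‖ / μ := by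
  set z := v i - frameProj v' (v i) with hz
  have hperp : ∀ j, inner ℝ (v' j) z = 0 := fun j => by
    rw [hz, inner_sub_right, inner_frameProj h'.orthonormal, sub_self]
  have hperp' : ∀ a : Fin k → ℝ, inner ℝ z (∑ j, a j • v' j) = 0 := fun a => by
    rw [inner_sum]
    refine Finset.sum_eq_zero fun j _ => ?_
    rw [real_inner_smul_right, real_inner_comm, hperp, mul_zero]
  obtain ⟨a, ha, hMa⟩ := h.eigen i
  choose a' ha' hMa' using h'.eigen
  have hv : v i = z + frameProj v' (v i) := by rw [hz]; abel
  have h1 : inner ℝ z (v i) = ‖z‖ ^ 2 := by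
    have e := congrArg (inner ℝ z) hv
    rwa [inner_add_right, frameProj_apply, hperp', add_zero, real_inner_self_eq_norm_sq] at e
  have h2 : inner ℝ z (M' (v i)) = inner ℝ z (M' z) := by
    have e : M' (frameProj v' (v i)) = ∑ j, (inner ℝ (v' j) (v i) * a' j) • v' j := by
      rw [frameProj_apply, map_sum]
      exact Finset.sum_congr rfl fun j _ => by rw [map_smul, hMa', smul_smul]
    have e' := congrArg (fun y => inner ℝ z (M' y)) hv
    rwa [map_add, inner_add_right, e, hperp', add_zero] at e'
  have h3 : inner ℝ z ((M - M') (v i)) = a * ‖z‖ ^ 2 - inner ℝ z (M' z) := by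
    rw [sub_apply, inner_sub_right, hMa, real_inner_smul_right, h1, h2]
  have h4 : -inner ℝ z ((M - M') (v i)) ≤ ‖z‖ * ‖M - M'‖ := by
    rw [← inner_neg_right]
    refine (real_inner_le_norm _ _).trans ?_
    rw [norm_neg]
    gcongr
    exact ((M - M').le_opNorm _).trans_eq (by rw [h.orthonormal.1 i, mul_one])
  have h5 := h'.nonneg z hperp
  rw [le_div_iff₀ hμ]
  rcases (norm_nonneg z).eq_or_lt with h0 | h0
  · rw [← h0, zero_mul]; exact norm_nonneg _
  · nlinarith [mul_nonneg (sub_nonneg.mpr ha) (sq_nonneg ‖z‖)]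

/-- A Davis–Kahan type bound: the reflection in the negative eigenspace is Lipschitz as a function
of the operator. -/
theorem IsNegFrame.norm_householder_sub_le (hμ : 0 < μ) (h : IsNegFrame M v μ)
    (h' : IsNegFrame M' v' μ) (y : E d) :
    ‖householder v y - householder v' y‖ ≤ 4 * k / μ * ‖M - M'‖ * ‖y‖ := by
  have e : householder v y - householder v' y = (2 : ℝ) • (frameProj v' (y - frameProj v y) -
      (frameProj v y - frameProj v' (frameProj v y))) := by
    rw [householder_apply, householder_apply, map_sub]
    module
  have b1 : ‖frameProj v y - frameProj v' (frameProj v y)‖ ≤ k * (‖y‖ * (‖M - M'‖ / μ)) := by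
    have e1 : frameProj v y - frameProj v' (frameProj v y) =
        ∑ i, inner ℝ (v i) y • (v i - frameProj v' (v i)) := by
      conv_lhs => rw [frameProj_apply v y, map_sum]
      simp only [map_smul, smul_sub, Finset.sum_sub_distrib]
    rw [e1]
    refine (norm_sum_le_of_le _ (n := fun _ => ‖y‖ * (‖M - M'‖ / μ)) fun i _ => ?_).trans_eq
      (by simp)
    rw [norm_smul]
    gcongr
    · exact (norm_inner_le_norm _ _).trans_eq (by rw [h.orthonormal.1 i, one_mul])
    · exact h.norm_sub_frameProj_le hμ h' i
  -- By self-adjointness, `⟪v' i, y - Q y⟫ = ⟪v' i - Q (v' i), y⟫` with `Q = frameProj v`, so the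
  -- previous bound applies with the two frames exchanged.
  have b2 : ‖frameProj v' (y - frameProj v y)‖ ≤ k * (‖M - M'‖ / μ * ‖y‖) := by
    rw [frameProj_apply]
    refine (norm_sum_le_of_le _ (n := fun _ => ‖M - M'‖ / μ * ‖y‖) fun i _ => ?_).trans_eq
      (by simp)
    rw [norm_smul, h'.orthonormal.1 i, mul_one, inner_sub_right, ← inner_frameProj_left,
      ← inner_sub_left]
    refine (norm_inner_le_norm _ _).trans ?_
    gcongr
    rw [norm_sub_rev M]
    exact h'.norm_sub_frameProj_le hμ h i
  rw [e, norm_smul, Real.norm_ofNat]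
  calc 2 * ‖frameProj v' (y - frameProj v y) - (frameProj v y - frameProj v' (frameProj v y))‖
      ≤ 2 * (k * (‖M - M'‖ / μ * ‖y‖) + k * (‖y‖ * (‖M - M'‖ / μ))) := by
        gcongr
        exact (norm_sub_le _ _).trans (add_le_add b2 b1)
    _ = 4 * k / μ * ‖M - M'‖ * ‖y‖ := by ring

variable {c : Fin m → E d → ℝ} {f : E d → ℝ} {x : E d}

theorem finrank_tangent (hx : LinearIndependent ℝ (fun i => gradient (c i) x)) :
    Module.finrank ℝ (tangent c x) = d - m := by
  have h := Submodule.finrank_add_finrank_orthogonal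
    (Submodule.span ℝ (Set.range fun i => gradient (c i) x))
  rw [finrank_span_eq_card hx, Fintype.card_fin, finrank_euclideanSpace, Fintype.card_fin] at h
  unfold tangent
  omega

variable {b b' : Fin (d - m) → E d} {l l' : Fin (d - m) → ℝ}

theorem IsEigenbasis.sum_inner_smul (hx : LinearIndependent ℝ (fun i => gradient (c i) x))
    (hb : IsEigenbasis c f x b l) {z : E d} (hz : z ∈ MCSD.tangent c x) :
    ∑ i, inner ℝ (b i) z • b i = z := by
  have hspan : Submodule.span ℝ (Set.range b) = MCSD.tangent c x := by
    refine Submodule.eq_of_le_of_finrank_eq (Submodule.span_le.mpr ?_) ?_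
    · rintro _ ⟨i, rfl⟩
      exact hb.tangent i
    · rw [finrank_span_eq_card hb.orthonormal.linearIndependent, Fintype.card_fin,
        finrank_tangent hx]
  rw [← hspan, Submodule.mem_span_range_iff_exists_fun] at hz
  obtain ⟨a, rfl⟩ := hz
  exact Finset.sum_congr rfl fun i _ => by rw [hb.orthonormal.inner_right_fintype]

theorem IsEigenbasis.hess_eq (hx : LinearIndependent ℝ (fun i => gradient (c i) x))
    (hb : IsEigenbasis c f x b l) {z : E d} (hz : z ∈ MCSD.tangent c x) :
    hess c f x z = ∑ i, (inner ℝ (b i) z * l i) • b i := by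
  conv_lhs => rw [← hb.sum_inner_smul hx hz, map_sum]
  exact Finset.sum_congr rfl fun i _ => by rw [map_smul, hb.eigen, smul_smul]

/-- The `b' j` coefficient of `hess (b i)` is computed in both bases. The eigenbasis expansion of
`hess` takes the place of a proof that `hess` is symmetric. -/
theorem IsEigenbasis.eigenvalue_eq (hx : LinearIndependent ℝ (fun i => gradient (c i) x))
    (hb : IsEigenbasis c f x b l) (hb' : IsEigenbasis c f x b' l') (i j : Fin (d - m))
    (h : inner ℝ (b' j) (b i) ≠ 0) : l i = l' j := by
  have h1 := congrArg (inner ℝ (b' j)) (hb'.hess_eq hx (hb.tangent i))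
  rw [hb.eigen, real_inner_smul_right, hb'.orthonormal.inner_right_fintype, mul_comm] at h1
  exact mul_left_cancel₀ h h1

theorem IsEigenbasis.sum_sq_inner (hx : LinearIndependent ℝ (fun i => gradient (c i) x))
    (hb' : IsEigenbasis c f x b' l') {z : E d} (hz : z ∈ MCSD.tangent c x) :
    ∑ j, inner ℝ (b' j) z ^ 2 = ‖z‖ ^ 2 := by
  have h := congrArg (inner ℝ z) (hb'.sum_inner_smul hx hz)
  rw [inner_sum, real_inner_self_eq_norm_sq] at h
  rw [← h]
  refine Finset.sum_congr rfl fun j _ => ?_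
  rw [real_inner_smul_right, real_inner_comm (b' j) z, pow_two]

/-- Double counting of the weights `⟪b' j, b i⟫²`, whose rows and columns sum to one: a nonzero
weight forces `l i = l' j`, so both counts are the same double sum. -/
theorem IsEigenbasis.card_neg_eq (hx : LinearIndependent ℝ (fun i => gradient (c i) x))
    (hb : IsEigenbasis c f x b l) (hb' : IsEigenbasis c f x b' l') :
    (Finset.univ.filter fun i => l i < 0).card = (Finset.univ.filter fun j => l' j < 0).card := by
  have h1 : ∀ i, (if l i < 0 then (1 : ℝ) else 0) =
      ∑ j, (if l i < 0 then 1 else 0) * inner ℝ (b' j) (b i) ^ 2 := fun i => by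
    rw [← Finset.mul_sum, hb'.sum_sq_inner hx (hb.tangent i), hb.orthonormal.1 i, one_pow, mul_one]
  have h2 : ∀ j, (if l' j < 0 then (1 : ℝ) else 0) =
      ∑ i, (if l' j < 0 then 1 else 0) * inner ℝ (b i) (b' j) ^ 2 := fun j => by
    rw [← Finset.mul_sum, hb.sum_sq_inner hx (hb'.tangent j), hb'.orthonormal.1 j, one_pow, mul_one]
  have h3 : (∑ i, if l i < 0 then (1 : ℝ) else 0) = ∑ j, if l' j < 0 then (1 : ℝ) else 0 := by
    rw [Finset.sum_congr rfl fun i _ => h1 i, Finset.sum_congr rfl fun j _ => h2 j,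
      Finset.sum_comm]
    refine Finset.sum_congr rfl fun j _ => Finset.sum_congr rfl fun i _ => ?_
    rw [real_inner_comm]
    by_cases h0 : inner ℝ (b' j) (b i) = 0
    · rw [real_inner_comm, h0]; simp
    · rw [hb.eigenvalue_eq hx hb' i j h0]
  rw [Finset.sum_boole, Finset.sum_boole] at h3
  exact_mod_cast h3

/-- The eigenvalue bounds of the strict saddle assumption hold for every sorted eigenbasis. -/
theorem IsEigenbasis.bounds (hx : LinearIndependent ℝ (fun i => gradient (c i) x))
    (hb : IsEigenbasis c f x b l) (hb' : IsEigenbasis c f x b' l') {L μ : ℝ} (hμ : 0 < μ)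
    (hl' : ∀ i : Fin (d - m), ((i : ℕ) < k → -L ≤ l' i ∧ l' i ≤ -μ) ∧
      (k ≤ (i : ℕ) → μ ≤ l' i ∧ l' i ≤ L)) :
    ∀ i : Fin (d - m), ((i : ℕ) < k → -L ≤ l i ∧ l i ≤ -μ) ∧
      (k ≤ (i : ℕ) → μ ≤ l i ∧ l i ≤ L) := by
  have hcard := hb.card_neg_eq hx hb'
  have hset : (Finset.univ.filter fun j => l' j < 0) =
      Finset.univ.filter fun j : Fin (d - m) => (j : ℕ) < k := by
    refine Finset.filter_congr fun j _ => ⟨fun h => ?_, fun h => ?_⟩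
    · by_contra hk
      linarith [((hl' j).2 (not_lt.mp hk)).1]
    · linarith [((hl' j).1 h).2]
  rw [hset] at hcard
  have hneg : ∀ i : Fin (d - m), (i : ℕ) < k → l i < 0 := by
    intro i hi
    by_contra hcon
    refine hcard.not_lt (Finset.card_lt_card ((Finset.ssubset_iff_of_subset ?_).mpr ⟨i, by simpa,
        by simpa using hcon⟩))
    intro j hj
    simp only [Finset.mem_filter, Finset.mem_univ, true_and] at hj ⊢
    by_contra hjk
    have : i ≤ j := Fin.le_def.mpr (by omega)
    linarith [hb.mono this, not_lt.mp hcon]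
  have hpos : ∀ i : Fin (d - m), k ≤ (i : ℕ) → 0 ≤ l i := by
    intro i hi
    by_contra hcon
    refine hcard.not_gt (Finset.card_lt_card ((Finset.ssubset_iff_of_subset ?_).mpr ⟨i,
        by simpa using hcon, by simpa⟩))
    intro j hj
    simp only [Finset.mem_filter, Finset.mem_univ, true_and] at hj ⊢
    have : j ≤ i := Fin.le_def.mpr (by omega)
    linarith [hb.mono this, not_le.mp hcon]
  intro i
  -- `b i` cannot be orthogonal to all `b' j`, so `l i` occurs among the `l'`; its sign then decides
  -- which of the two bounds it inherits.
  obtain ⟨j, hj⟩ : ∃ j, l i = l' j := by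
    by_contra! hcon
    have h0 : ∀ j, inner ℝ (b' j) (b i) = 0 := fun j => by
      by_contra h
      exact hcon j (hb.eigenvalue_eq hx hb' i j h)
    have := hb'.sum_sq_inner hx (hb.tangent i)
    simp [h0, hb.orthonormal.1 i] at this
  refine ⟨fun hi => ?_, fun hi => ?_⟩
  · have := hneg i hi
    rw [hj] at this ⊢
    refine (hl' j).1 ?_
    by_contra hjk
    linarith [((hl' j).2 (not_lt.mp hjk)).1]
  · have := hpos i hi
    rw [hj] at this ⊢
    refine (hl' j).2 ?_
    by_contra hjk
    linarith [((hl' j).1 (not_le.mp hjk)).2]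

/-- Composition with `P` extends the Hessian by zero to normal vectors, so Hessians at different
points become comparable operators on one space. The price is that the complement is only
nonnegative. -/
theorem IsEigenbasis.isNegFrame (hx : LinearIndependent ℝ (fun i => gradient (c i) x))
    (hb : IsEigenbasis c f x b l) (hk : k ≤ d - m) {μ : ℝ} (hμ : 0 < μ)
    (hneg : ∀ i : Fin (d - m), (i : ℕ) < k → l i ≤ -μ)
    (hpos : ∀ i : Fin (d - m), k ≤ (i : ℕ) → μ ≤ l i) (hv : ∀ i, v i = b (Fin.castLE hk i)) :
    IsNegFrame ((hess c f x).comp (proj c x)) v μ where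
  orthonormal := by
    rw [show v = b ∘ Fin.castLE hk from funext hv]
    exact hb.orthonormal.comp _ (Fin.castLE_injective hk)
  eigen i := by
    refine ⟨l (Fin.castLE hk i), hneg _ i.2, ?_⟩
    rw [hv, ContinuousLinearMap.comp_apply, proj_eq_self_iff.mpr (hb.tangent _), hb.eigen]
  nonneg z hz := by
    rw [ContinuousLinearMap.comp_apply, hb.hess_eq hx (proj_mem x z), inner_sum]
    refine Finset.sum_nonneg fun i _ => ?_
    have h1 : inner ℝ (b i) (proj c x z) = inner ℝ (b i) z := by
      rw [real_inner_comm, inner_proj_left (hb.tangent i), real_inner_comm]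
    rw [real_inner_smul_right, h1, real_inner_comm (b i) z]
    rcases lt_or_ge (i : ℕ) k with hi | hi
    · have := hz ⟨i, hi⟩
      rw [hv] at this
      have h2 : inner ℝ (b i) z = 0 := this
      rw [h2]; simp
    · have := hpos i hi
      have hl : 0 ≤ l i := hμ.le.trans this
      have h3 : inner ℝ (b i) z * l i * inner ℝ (b i) z = l i * inner ℝ (b i) z ^ 2 := by ring
      rw [h3]
      positivity

theorem householder_mem {v : Fin k → E d} (hv : ∀ i, v i ∈ tangent c x) {y : E d}
    (hy : y ∈ tangent c x) : householder v y ∈ tangent c x := by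
  rw [householder_apply, frameProj_apply]
  exact sub_mem hy (Submodule.smul_mem _ _ (Submodule.sum_mem _ fun i _ =>
    Submodule.smul_mem _ _ (hv i)))

theorem IsEigenbasis.householder_apply_basis (hb : IsEigenbasis c f x b l) (hk : k ≤ d - m)
    (hv : ∀ i, v i = b (Fin.castLE hk i)) (i : Fin (d - m)) :
    householder v (b i) = (if (i : ℕ) < k then (-1 : ℝ) else 1) • b i := by
  rw [householder_apply, frameProj_apply]
  have h1 : ∀ j, inner ℝ (v j) (b i) = if Fin.castLE hk j = i then (1 : ℝ) else 0 := fun j => by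
    rw [hv]; exact orthonormal_iff_ite.mp hb.orthonormal _ _
  split_ifs with hi
  · rw [Finset.sum_eq_single ⟨i, hi⟩]
    · have e : Fin.castLE hk ⟨i, hi⟩ = i := Fin.ext rfl
      rw [h1, hv, e, if_pos rfl]
      module
    · intro j _ hj
      rw [h1, if_neg, zero_smul]
      rintro rfl
      exact hj (Fin.ext rfl)
    · simp
  · rw [Finset.sum_eq_zero]
    · module
    · intro j _
      rw [h1, if_neg, zero_smul]
      rintro rfl
      exact hi j.2

end SpectralFrames

/-! ### The step as a linear map plus a quadratic remainder. -/

section Expansion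

theorem exists_quadratic_remainder {X Y : Type*} [NormedAddCommGroup X] [NormedSpace ℝ X]
    [NormedAddCommGroup Y] [NormedSpace ℝ Y] {F : X → Y} {x₀ : X} (hF : ContDiffAt ℝ 2 F x₀) :
    ∃ C ≥ 0, ∃ ρ > 0, ∀ x ∈ Metric.ball x₀ ρ,
      ‖F x - F x₀ - fderiv ℝ F x₀ (x - x₀)‖ ≤ C * ‖x - x₀‖ ^ 2 := by
  have hD : ContDiffAt ℝ 1 (fderiv ℝ F) x₀ := hF.fderiv_right (m := 1) (by norm_num)
  obtain ⟨K, s, hs, hK⟩ := hD.exists_lipschitzOnWith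
  have hd : ∀ᶠ x in 𝓝 x₀, DifferentiableAt ℝ F x := by
    filter_upwards [hF.eventually (by simp)] with x h
    exact h.differentiableAt (by simp)
  obtain ⟨ρ, hρ, h⟩ := Metric.eventually_nhds_iff_ball.mp (hd.and hs)
  refine ⟨K, K.2, ρ, hρ, fun x hx => ?_⟩
  have hsub : Metric.closedBall x₀ ‖x - x₀‖ ⊆ Metric.ball x₀ ρ :=
    Metric.closedBall_subset_ball (mem_ball_iff_norm.mp hx)
  have := Convex.norm_image_sub_le_of_norm_fderiv_le' (f := F) (φ := fderiv ℝ F x₀)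
    (C := K * ‖x - x₀‖) (fun y hy => (h y (hsub hy)).1) (fun y hy => ?_)
    (convex_closedBall x₀ ‖x - x₀‖) (Metric.mem_closedBall_self (norm_nonneg _))
    (mem_closedBall_iff_norm.mpr le_rfl)
  · rwa [mul_assoc, ← pow_two] at this
  · refine (hK.norm_sub_le (h y (hsub hy)).2 (mem_of_mem_nhds hs)).trans ?_
    gcongr
    exact mem_closedBall_iff_norm.mp hy

theorem norm_fst_le_pairNorm (p : E d × E d) : ‖p.1‖ ≤ pairNorm p :=
  Real.le_sqrt_of_sq_le (le_add_of_nonneg_right (sq_nonneg _))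

theorem norm_snd_le_pairNorm (p : E d × E d) : ‖p.2‖ ≤ pairNorm p :=
  Real.le_sqrt_of_sq_le (le_add_of_nonneg_left (sq_nonneg _))

theorem pairNorm_nonneg (p : E d × E d) : 0 ≤ pairNorm p := Real.sqrt_nonneg _

theorem pairNorm_le_add (p : E d × E d) : pairNorm p ≤ ‖p.1‖ + ‖p.2‖ := by
  rw [pairNorm, Real.sqrt_le_iff]
  refine ⟨by positivity, ?_⟩
  nlinarith [mul_nonneg (norm_nonneg p.1) (norm_nonneg p.2)]

variable {c : Fin m → E d → ℝ} {f : E d → ℝ} {xs x : E d} {ε B : ℝ}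

theorem contDiffAt_rgrad (hc : ∀ i, ContDiff ℝ ∞ (c i)) (hf : ContDiff ℝ ∞ f)
    (hx : LinearIndependent ℝ (fun i => gradient (c i) x)) : ContDiffAt ℝ ∞ (rgrad c f) x :=
  (contDiffAt_proj hc hx).clm_apply (contDiff_gradient hf).contDiffAt

theorem exists_hess_lipschitz (hc : ∀ i, ContDiff ℝ ∞ (c i)) (hf : ContDiff ℝ ∞ f)
    (hx : LinearIndependent ℝ (fun i => gradient (c i) xs)) :
    ∃ C ≥ 0, ∃ ρ > 0, ∀ x ∈ Metric.ball xs ρ, ‖(hess c f x).comp (proj c x) -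
      (hess c f xs).comp (proj c xs)‖ ≤ C * ‖x - xs‖ := by
  have hP : ContDiffAt ℝ 1 (proj c) xs := (contDiffAt_proj hc hx).of_le (by norm_cast)
  have hD : ContDiffAt ℝ 1 (fderiv ℝ (rgrad c f)) xs :=
    (contDiffAt_rgrad hc hf hx).fderiv_right (m := 1) (by norm_cast)
  have hM : ContDiffAt ℝ 1 (fun x => (hess c f x).comp (proj c x)) xs :=
    (hP.clm_comp hD).clm_comp hP
  obtain ⟨K, s, hs, hK⟩ := hM.exists_lipschitzOnWith
  obtain ⟨ρ, hρ, h⟩ := Metric.mem_nhds_iff.mp hs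
  exact ⟨K, K.2, ρ, hρ, fun x hxρ => hK.norm_sub_le (h hxρ) (mem_of_mem_nhds hs)⟩

/-- Differentiating `P grad f = grad f` produces a term `DP` applied to `grad f`, which vanishes at
a critical point; hence `D grad f = P D grad f` there. -/
theorem fderiv_rgrad_eq_hess (hc : ∀ i, ContDiff ℝ ∞ (c i)) (hf : ContDiff ℝ ∞ f)
    (hx : LinearIndependent ℝ (fun i => gradient (c i) xs)) (hcrit : rgrad c f xs = 0) :
    fderiv ℝ (rgrad c f) xs = hess c f xs := by
  have hP : HasFDerivAt (proj c) (fderiv ℝ (proj c) xs) xs :=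
    (((contDiffAt_proj hc hx).of_le (m := 1) (by norm_cast)).differentiableAt (by simp)).hasFDerivAt
  have hr : HasFDerivAt (rgrad c f) (fderiv ℝ (rgrad c f) xs) xs :=
    (((contDiffAt_rgrad hc hf hx).of_le (m := 1) (by norm_cast)).differentiableAt
      (by simp)).hasFDerivAt
  have h := hP.clm_apply hr
  have e : (fun x => proj c x (rgrad c f x)) = rgrad c f := funext fun x => proj_proj _ _
  rw [e, hcrit] at h
  have := h.unique hr
  rw [← this, hess, ← this]
  ext1 v
  simp

/-- Second order estimates for one exponential step with transport inside the tube. -/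
theorem ExpTransport.estimates (hc : ∀ i, ContDiff ℝ ∞ (c i)) (hT : IsTube c xs ε B)
    {u w y z : E d} (h : ExpTransport c x u w y z) (hε : ‖x - xs‖ + ‖u‖ < ε) :
    y ∈ feasible c ∧ z ∈ tangent c y ∧ ‖y - x‖ ≤ ‖u‖ ∧ ‖y - x - u‖ ≤ B * ‖u‖ ^ 2 ∧
      ‖z - w‖ ≤ B * ‖u‖ * ‖w‖ ∧ ‖z‖ = ‖w‖ ∧ geodesicDist c y x ≤ ‖u‖ₑ := by
  obtain ⟨g, V, hg, rfl, rfl, rfl, hV, rfl, rfl⟩ := h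
  have h1 : (1 : ℝ) ∈ Icc (0 : ℝ) 1 := right_mem_Icc.mpr zero_le_one
  have hb := hg.mapsTo_ball hc hε
  exact ⟨hg.feasible 1 h1, hV.tangent 1 h1, hg.norm_sub_le hc h1, hg.norm_sub_sub_le hc hT hb,
    hV.norm_sub_le hc hT hg hb h1, hV.norm_eq h1, hg.geodesicDist_le hc⟩

theorem IsCoord.mono {r r' : ℝ} (hr : r ≤ r') {w : E d} {p : E d × E d}
    (h : IsCoord c xs r x w p) : IsCoord c xs r' x w p :=
  ⟨h.1, h.2.1, h.2.2.1.trans_le hr, h.2.2.2⟩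

/-- The displacement `-dt (I - 2 ∑ v_i v_iᵀ) grad f(x) + γ w` of one step. -/
noncomputable def displacement (c : Fin m → E d → ℝ) (f : E d → ℝ) (dt γ : ℝ) (x w : E d)
    (v : Fin k → E d) : E d :=
  -(dt • householder v (rgrad c f x)) + γ • w

/-- The linearisation of the displacement at `xs`. -/
noncomputable def linDisplacement (c : Fin m → E d → ℝ) (f : E d → ℝ) (dt γ : ℝ) (xs : E d)
    (vs : Fin k → E d) (p : E d × E d) : E d :=
  -(dt • householder vs (hess c f xs p.1)) + γ • p.2

theorem linIter_apply (dt γ : ℝ) (vs : Fin k → E d) (p : E d × E d) :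
    linIter c f dt γ xs vs p = (p.1 + linDisplacement c f dt γ xs vs p,
      linDisplacement c f dt γ xs vs p) := by
  simp only [linIter, blockOp, linDisplacement, ContinuousLinearMap.prod_apply,
    add_apply, ContinuousLinearMap.comp_apply, sub_apply,
    smul_apply, neg_apply, ContinuousLinearMap.coe_fst',
    ContinuousLinearMap.coe_snd', ContinuousLinearMap.id_apply]
  refine Prod.ext ?_ rfl
  dsimp only
  abel

theorem IsUnstableFrame.isNegFrame {hk : k ≤ d - m} {v : Fin k → E d} {δ L μ : ℝ}
    (hlicq : LICQ c) (hμ : 0 < μ) (hsaddle : StrictSaddle c f k xs δ L μ)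
    (hx : x ∈ feasible c) (hd : geodesicDist c x xs < ENNReal.ofReal δ)
    (hv : IsUnstableFrame c f hk x v) : IsNegFrame ((hess c f x).comp (proj c x)) v μ := by
  obtain ⟨b, l, hb, hvb⟩ := hv
  obtain ⟨b', l', hb', hl'⟩ := hsaddle x hx hd
  have hl := hb.bounds (hlicq x hx) hb' hμ hl'
  exact hb.isNegFrame (hlicq x hx) hk hμ (fun i hi => ((hl i).1 hi).2) (fun i hi => ((hl i).2 hi).1)
    hvb

theorem geodesicDist_self (hx : x ∈ feasible c) : geodesicDist c x x = 0 := by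
  refine le_antisymm ((iInf₂_le (fun _ => x) ⟨contDiffOn_const, fun _ _ => hx, rfl, rfl⟩).trans ?_)
    bot_le
  simp

/-- The constant is uniform over all admissible frames `v`, and the momentum is unrestricted: it
enters only through `‖w - ρ‖ ≤ B ‖ζ‖ ‖ρ‖`. -/
theorem exists_displacement_bound (hk : k ≤ d - m) (hc : ∀ i, ContDiff ℝ ∞ (c i))
    (hlicq : LICQ c) (hf : ContDiff ℝ ∞ f) (hxs : xs ∈ feasible c) (hcrit : rgrad c f xs = 0)
    {δ L μ : ℝ} (hδ : 0 < δ) (hμ : 0 < μ) (hsaddle : StrictSaddle c f k xs δ L μ)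
    {vs : Fin k → E d} (hvs : IsUnstableFrame c f hk xs vs) (dt γ : ℝ) :
    ∃ C ≥ 0, ∃ r > 0, ∀ x w p, IsCoord c xs r x w p → ∀ v, IsUnstableFrame c f hk x v →
      ‖displacement c f dt γ x w v - linDisplacement c f dt γ xs vs p‖ ≤ C * pairNorm p ^ 2 := by
  have hx := hlicq xs hxs
  obtain ⟨ε, B, hT⟩ := exists_isTube hc hx
  obtain ⟨C₁, hC₁, ρ₁, hρ₁, hlip⟩ := exists_hess_lipschitz hc hf hx
  obtain ⟨C₂, hC₂, ρ₂, hρ₂, hquad⟩ := exists_quadratic_remainder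
    ((contDiffAt_rgrad hc hf hx).of_le (m := 2) (by norm_cast))
  rw [fderiv_rgrad_eq_hess hc hf hx hcrit, hcrit] at hquad
  have hB := hT.nonneg
  have hneg : IsNegFrame ((hess c f xs).comp (proj c xs)) vs μ :=
    hvs.isNegFrame hlicq hμ hsaddle hxs (by rw [geodesicDist_self hxs]; simpa using hδ)
  set H := hess c f xs
  set C₃ := C₂ + ‖H‖ * B
  have hC₃ : 0 ≤ C₃ := by positivity
  refine ⟨|dt| * (4 * k / μ * C₁ * (‖H‖ + C₃) + (1 + 2 * k) * C₃) + |γ| * B, by positivity,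
    min (min ε δ) (min (min ρ₁ ρ₂) 1),
    lt_min (lt_min hT.pos hδ) (lt_min (lt_min hρ₁ hρ₂) one_pos), fun x w p hp v hv => ?_⟩
  obtain ⟨-, -, hpr, hexp⟩ := hp
  have hpε : ‖p.1‖ < ε := hpr.trans_le ((min_le_left _ _).trans (min_le_left _ _))
  have hpδ : ‖p.1‖ < δ := hpr.trans_le ((min_le_left _ _).trans (min_le_right _ _))
  have hpρ₁ : ‖p.1‖ < ρ₁ :=
    hpr.trans_le ((min_le_right _ _).trans ((min_le_left _ _).trans (min_le_left _ _)))
  have hpρ₂ : ‖p.1‖ < ρ₂ :=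
    hpr.trans_le ((min_le_right _ _).trans ((min_le_left _ _).trans (min_le_right _ _)))
  have hp1 : ‖p.1‖ ≤ 1 := (hpr.trans_le ((min_le_right _ _).trans (min_le_right _ _))).le
  obtain ⟨hxf, -, hdx, hdx2, hdw, -, hgd⟩ := hexp.estimates hc hT
    (by rwa [sub_self, norm_zero, zero_add])
  have hgd' : geodesicDist c x xs < ENNReal.ofReal δ := by
    refine hgd.trans_lt ?_
    rw [← ofReal_norm]
    exact (ENNReal.ofReal_lt_ofReal_iff hδ).mpr hpδ
  have hvneg := hv.isNegFrame hlicq hμ hsaddle hxf hgd'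
  have h1 : ‖rgrad c f x - H p.1‖ ≤ C₃ * ‖p.1‖ ^ 2 := by
    have e : rgrad c f x - H p.1 = (rgrad c f x - 0 - H (x - xs)) + H (x - xs - p.1) := by
      simp only [map_sub]; abel
    rw [e]
    calc _ ≤ C₂ * ‖x - xs‖ ^ 2 + ‖H‖ * (B * ‖p.1‖ ^ 2) :=
          (norm_add_le _ _).trans (add_le_add
            (hquad x (mem_ball_iff_norm.mpr (hdx.trans_lt hpρ₂)))
            ((H.le_opNorm _).trans (by gcongr)))
      _ ≤ C₂ * ‖p.1‖ ^ 2 + ‖H‖ * (B * ‖p.1‖ ^ 2) := by gcongr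
      _ = C₃ * ‖p.1‖ ^ 2 := by ring
  have h2 : ‖rgrad c f x‖ ≤ (‖H‖ + C₃) * ‖p.1‖ := by
    have e : rgrad c f x = H p.1 + (rgrad c f x - H p.1) := by abel
    rw [e]
    calc _ ≤ ‖H‖ * ‖p.1‖ + C₃ * ‖p.1‖ ^ 2 := (norm_add_le _ _).trans (add_le_add (H.le_opNorm _) h1)
      _ ≤ ‖H‖ * ‖p.1‖ + C₃ * (‖p.1‖ * 1) := by rw [pow_two]; gcongr
      _ = (‖H‖ + C₃) * ‖p.1‖ := by ring
  have h3 : ‖householder v (rgrad c f x) - householder vs (H p.1)‖ ≤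
      (4 * k / μ * C₁ * (‖H‖ + C₃) + (1 + 2 * k) * C₃) * ‖p.1‖ ^ 2 := by
    -- The first difference is a product of two `O(‖ζ‖)` factors, the change of the reflection and
    -- the gradient; the second is the Taylor error of the gradient.
    have e : householder v (rgrad c f x) - householder vs (H p.1) =
        (householder v (rgrad c f x) - householder vs (rgrad c f x)) +
          householder vs (rgrad c f x - H p.1) := by
      rw [map_sub]; abel
    rw [e]
    calc _ ≤ 4 * k / μ * (C₁ * ‖p.1‖) * ((‖H‖ + C₃) * ‖p.1‖) + (1 + 2 * k) * (C₃ * ‖p.1‖ ^ 2) := by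
          refine (norm_add_le _ _).trans (add_le_add
            ((hvneg.norm_householder_sub_le hμ hneg _).trans ?_)
            ((norm_householder_le hneg.orthonormal _).trans ?_))
          · gcongr
            exact (hlip x (mem_ball_iff_norm.mpr (hdx.trans_lt hpρ₁))).trans (by gcongr)
          · gcongr
      _ = _ := by ring
  have e : displacement c f dt γ x w v - linDisplacement c f dt γ xs vs p =
      -(dt • (householder v (rgrad c f x) - householder vs (H p.1))) + γ • (w - p.2) := by
    simp only [displacement, linDisplacement, smul_sub, H]
    abel
  have i0 := pairNorm_nonneg p
  have i1 := norm_fst_le_pairNorm p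
  have i2 := norm_snd_le_pairNorm p
  rw [e]
  calc _ ≤ |dt| * ((4 * k / μ * C₁ * (‖H‖ + C₃) + (1 + 2 * k) * C₃) * pairNorm p ^ 2) +
        |γ| * (B * pairNorm p * pairNorm p) := by
        refine (norm_add_le _ _).trans (add_le_add ?_ ?_)
        · rw [norm_neg, norm_smul, Real.norm_eq_abs]
          gcongr
          exact h3.trans (by gcongr)
        · rw [norm_smul, Real.norm_eq_abs]
          gcongr
          exact hdw.trans (by gcongr)
    _ = _ := by ring

/-- Up to quadratic errors `ζ' ≈ y - xs`, `y ≈ x + u`, `x ≈ xs + ζ` and `ρ' ≈ z ≈ u` as ambient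
vectors. No comparison of transports around a geodesic triangle is needed. -/
theorem exists_stepExpansion (hk : k ≤ d - m) (hc : ∀ i, ContDiff ℝ ∞ (c i))
    (hlicq : LICQ c) (hf : ContDiff ℝ ∞ f) (hxs : xs ∈ feasible c) (hcrit : rgrad c f xs = 0)
    {δ L μ : ℝ} (hδ : 0 < δ) (hμ : 0 < μ) (hsaddle : StrictSaddle c f k xs δ L μ)
    {vs : Fin k → E d} (hvs : IsUnstableFrame c f hk xs vs) (dt γ : ℝ) :
    ∃ r₀ > 0, ∀ r, 0 < r → r ≤ r₀ → ∃ C rs, 0 < C ∧ 0 < rs ∧ rs ≤ r ∧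
      StepExpansion c f hk dt γ xs (linIter c f dt γ xs vs) r C rs := by
  have hx := hlicq xs hxs
  obtain ⟨ε, B, hT⟩ := exists_isTube hc hx
  obtain ⟨η₀, hη₀, hex⟩ := exists_geodesic_parallel hc hx
  obtain ⟨C, hC, r', hr', hdisp⟩ :=
    exists_displacement_bound hk hc hlicq hf hxs hcrit hδ hμ hsaddle hvs dt γ
  have hB := hT.nonneg
  have hvo : Orthonormal ℝ vs := (hvs.isNegFrame hlicq hμ hsaddle hxs
    (by rw [geodesicDist_self hxs]; simpa using hδ)).orthonormal
  refine ⟨min (min r' ε) (min δ (1 / (2 * (B + 1)))),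
    lt_min (lt_min hr' hT.pos) (lt_min hδ (by positivity)), fun r hr hrr => ?_⟩
  have hrr' : r ≤ r' := (hrr.trans (min_le_left _ _)).trans (min_le_left _ _)
  have hrε : r ≤ ε := (hrr.trans (min_le_left _ _)).trans (min_le_right _ _)
  have hrδ : r ≤ δ := (hrr.trans (min_le_right _ _)).trans (min_le_left _ _)
  have hBr : B * r ≤ 1 / 2 := by
    have h : r ≤ 1 / (2 * (B + 1)) := (hrr.trans (min_le_right _ _)).trans (min_le_right _ _)
    rw [le_div_iff₀ (by positivity)] at h
    linarith
  obtain ⟨ρ₁, hρ₁, hcoord⟩ := exists_coord hc hxs hx hr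
  set H := hess c f xs with hH
  -- `a` bounds `‖x - xs‖ + ‖u‖` by `a * pairNorm p`; the thresholds in `σ` then keep the step
  -- inside the tube, the existence range and the coordinate range.
  set a : ℝ := 1 + (|dt| * ((1 + 2 * k) * ‖H‖) + |γ| + C) with ha
  have ha1 : 1 ≤ a := le_add_of_nonneg_right (by positivity)
  have ha0 : 0 < a := one_pos.trans_le ha1
  set σ := min (min ε η₀) ρ₁
  have hσ : 0 < σ := lt_min (lt_min hT.pos hη₀) hρ₁
  have basic : ∀ x w p, IsCoord c xs r x w p → pairNorm p < min (min r 1) (σ / a) →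
      x ∈ feasible c ∧ geodesicDist c x xs < ENNReal.ofReal δ ∧ w ∈ tangent c x ∧
      ‖x - xs - p.1‖ ≤ B * ‖p.1‖ ^ 2 ∧
      ∀ v, IsUnstableFrame c f hk x v → displacement c f dt γ x w v ∈ tangent c x ∧
        ‖x - xs‖ + ‖displacement c f dt γ x w v‖ ≤ a * pairNorm p ∧ a * pairNorm p < σ := by
    intro x w p hp hpn
    have hpn1 : pairNorm p ≤ 1 := (hpn.trans_le ((min_le_left _ _).trans (min_le_right _ _))).le
    have hpnσ : a * pairNorm p < σ := by
      have := hpn.trans_le (min_le_right _ _)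
      rwa [lt_div_iff₀' ha0] at this
    have hp0 := pairNorm_nonneg p
    have i1 := norm_fst_le_pairNorm p
    have i2 := norm_snd_le_pairNorm p
    obtain ⟨hxf, hwT, hdx, hdx2, hdw, -, hgd⟩ := hp.2.2.2.estimates hc hT
      (by rw [sub_self, norm_zero, zero_add]; exact hp.2.2.1.trans_le hrε)
    have hgd' : geodesicDist c x xs < ENNReal.ofReal δ := by
      refine hgd.trans_lt ?_
      rw [← ofReal_norm]
      exact (ENNReal.ofReal_lt_ofReal_iff hδ).mpr (hp.2.2.1.trans_le hrδ)
    refine ⟨hxf, hgd', hwT, hdx2, fun v hv => ⟨?_, ?_, hpnσ⟩⟩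
    · refine add_mem (neg_mem (Submodule.smul_mem _ _ (householder_mem ?_ (proj_mem _ _))))
        (Submodule.smul_mem _ _ hwT)
      obtain ⟨b, l, hb, hvb⟩ := hv
      exact fun i => hvb i ▸ hb.tangent _
    · have h1 := hdisp x w p (hp.mono hrr') v hv
      have h2 : ‖linDisplacement c f dt γ xs vs p‖ ≤
          (|dt| * ((1 + 2 * k) * ‖H‖) + |γ|) * pairNorm p := by
        rw [linDisplacement]
        refine (norm_add_le _ _).trans ?_
        rw [norm_neg, norm_smul, norm_smul, Real.norm_eq_abs, Real.norm_eq_abs, add_mul, mul_assoc]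
        gcongr
        refine (norm_householder_le hvo _).trans ?_
        rw [mul_assoc]
        gcongr
        exact (H.le_opNorm _).trans (by gcongr)
      have h3 := norm_le_norm_add_norm_sub' (displacement c f dt γ x w v)
        (linDisplacement c f dt γ xs vs p)
      have h4 : C * pairNorm p ^ 2 ≤ C * pairNorm p := by
        gcongr
        rw [pow_two]
        exact mul_le_of_le_one_left hp0 hpn1
      have h5 : ‖x - xs‖ ≤ pairNorm p := hdx.trans i1
      calc _ ≤ pairNorm p + ((|dt| * ((1 + 2 * k) * ‖H‖) + |γ|) * pairNorm p + C * pairNorm p) := by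
            linarith
        _ = a * pairNorm p := by rw [ha]; ring
  -- `9 = 4 + 1 + 1` from the position plus `2 + 1` from the momentum, `2 * C` from the displacement
  -- in both; the final `1` only secures positivity.
  refine ⟨9 * B * a ^ 2 + 2 * C + 1, min (min r 1) (σ / a), by positivity,
    lt_min (lt_min hr one_pos) (by positivity), (min_le_left _ _).trans (min_le_left _ _), ?_, ?_⟩
  · intro x w p hp hpn
    obtain ⟨hxf, hgd, -, -, hu⟩ := basic x w p hp hpn
    obtain ⟨b, l, hb, -⟩ := hsaddle x hxf hgd
    have hv : IsUnstableFrame c f hk x (fun i => b (Fin.castLE hk i)) := ⟨b, l, hb, fun _ => rfl⟩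
    obtain ⟨huT, hun, hσ'⟩ := hu _ hv
    have hση : σ ≤ η₀ := (min_le_left _ _).trans (min_le_right _ _)
    have n1 := norm_nonneg (x - xs)
    have n2 := norm_nonneg (displacement c f dt γ x w fun i => b (Fin.castLE hk i))
    obtain ⟨g, W, hg, hg0, hgu, hW, hW0⟩ := hex x hxf (by linarith) _ huT (by linarith) _ huT
    exact ⟨_, g 1, W 1, hv, g, W, hg, hg0, hgu, rfl, hW, hW0, rfl⟩
  · intro x w p hp hpn v y z hstep
    obtain ⟨hxf, -, -, hdx, hu⟩ := basic x w p hp hpn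
    obtain ⟨hv, hexp⟩ := hstep
    obtain ⟨-, hun, hσ'⟩ := hu v hv
    have hd := hdisp x w p (hp.mono hrr') v hv
    change ExpTransport c x (displacement c f dt γ x w v) (displacement c f dt γ x w v) y z at hexp
    set u := displacement c f dt γ x w v
    set K := linDisplacement c f dt γ xs vs p
    have hσε : σ ≤ ε := (min_le_left _ _).trans (min_le_left _ _)
    have hσρ : σ ≤ ρ₁ := min_le_right _ _
    obtain ⟨hyf, hzT, hyx, hyxu, hzu, hzn, -⟩ := hexp.estimates hc hT (by linarith)
    have hy : ‖y - xs‖ ≤ a * pairNorm p := by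
      have := norm_sub_le_norm_sub_add_norm_sub y x xs
      linarith
    obtain ⟨p', hp'⟩ := hcoord y hyf (by linarith) z hzT
    obtain ⟨-, -, -, hdy, hdz, hzn', -⟩ := hp'.2.2.2.estimates hc hT
      (by rw [sub_self, norm_zero, zero_add]; exact hp'.2.2.1.trans_le hrε)
    have hp0 := pairNorm_nonneg p
    -- Since `B r ≤ 1/2`, the quadratic error in `y - xs ≈ ζ'` is absorbed at the cost of a factor
    -- two.
    have hζ' : ‖p'.1‖ ≤ 2 * (a * pairNorm p) := by
      have h1 : B * ‖p'.1‖ ^ 2 ≤ 1 / 2 * ‖p'.1‖ := by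
        rw [pow_two, ← mul_assoc]
        gcongr
        exact (mul_le_mul_of_nonneg_left hp'.2.2.1.le hB).trans hBr
      have h2 := norm_sub_norm_le p'.1 (y - xs)
      rw [norm_sub_rev p'.1] at h2
      linarith
    have hu' : ‖u‖ ≤ a * pairNorm p := by linarith [norm_nonneg (x - xs)]
    have i1 := norm_fst_le_pairNorm p
    have h1a : ‖p.1‖ ≤ a * pairNorm p := i1.trans (le_mul_of_one_le_left hp0 ha1)
    refine ⟨p', hp', (pairNorm_le_add _).trans ?_⟩
    rw [linIter_apply]
    have e1 : (p' - (p.1 + K, K)).1 =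
        -(y - xs - p'.1) + (y - x - u) + (x - xs - p.1) + (u - K) := by
      change p'.1 - (p.1 + K) = _; abel
    have e2 : (p' - (p.1 + K, K)).2 = -(z - p'.2) + (z - u) + (u - K) := by
      change p'.2 - K = _; abel
    have b1 : ‖y - xs - p'.1‖ ≤ B * (2 * (a * pairNorm p)) ^ 2 := hdy.trans (by gcongr)
    have b2 : ‖y - x - u‖ ≤ B * (a * pairNorm p) ^ 2 := hyxu.trans (by gcongr)
    have b3 : ‖x - xs - p.1‖ ≤ B * (a * pairNorm p) ^ 2 := hdx.trans (by gcongr)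
    have b4 : ‖z - p'.2‖ ≤ B * (2 * (a * pairNorm p)) * (a * pairNorm p) := by
      refine hdz.trans ?_
      rw [← hzn', hzn]
      gcongr
    have b5 : ‖z - u‖ ≤ B * (a * pairNorm p) * (a * pairNorm p) := hzu.trans (by gcongr)
    have c1 : ‖(p' - (p.1 + K, K)).1‖ ≤
        ‖y - xs - p'.1‖ + ‖y - x - u‖ + ‖x - xs - p.1‖ + ‖u - K‖ := by
      rw [e1, ← norm_neg (y - xs - p'.1)]
      exact norm_add₄_le
    have c2 : ‖(p' - (p.1 + K, K)).2‖ ≤ ‖z - p'.2‖ + ‖z - u‖ + ‖u - K‖ := by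
      rw [e2, ← norm_neg (z - p'.2)]
      exact norm_add₃_le
    calc _ ≤ (B * (2 * (a * pairNorm p)) ^ 2 + B * (a * pairNorm p) ^ 2 +
          B * (a * pairNorm p) ^ 2 + C * pairNorm p ^ 2) +
          (B * (2 * (a * pairNorm p)) * (a * pairNorm p) +
            B * (a * pairNorm p) * (a * pairNorm p) + C * pairNorm p ^ 2) := by
          refine add_le_add (c1.trans ?_) (c2.trans ?_)
          · exact add_le_add (add_le_add (add_le_add b1 b2) b3) hd
          · exact add_le_add (add_le_add b4 b5) hd
      _ = (9 * B * a ^ 2 + 2 * C) * pairNorm p ^ 2 := by ring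
      _ ≤ _ := by
          exact mul_le_mul_of_nonneg_right (le_add_of_nonneg_right zero_le_one) (sq_nonneg _)

end Expansion

/-! ### Power bound for the linear part and decay of the nonlinear iteration. -/

section Convergence

/-- Solutions of a two-term recurrence whose characteristic roots have modulus `β` decay at every
rate `q > β`. -/
theorem abs_le_of_recurrence {β q τ : ℝ} (hβ : 0 ≤ β) (hq : β < q) (hτ : |τ| ≤ 2 * β) {s : ℕ → ℝ}
    (hs : ∀ n, s (n + 2) = τ * s (n + 1) - β ^ 2 * s n) (n : ℕ) :
    |s n| ≤ q ^ n * (|s 0| + (|s 1| + β * |s 0|) / (q - β)) := by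
  have hq0 : 0 < q := hβ.trans_lt hq
  have hqβ : 0 < q - β := sub_pos.mpr hq
  have hτ' : ∀ x y : ℝ, |τ * (x * y)| ≤ 2 * β * (|x| * |y|) := fun x y => by
    rw [abs_mul, abs_mul]; gcongr
  set w := |s 1| + β * |s 0|
  have hw : 0 ≤ w := by positivity
  -- The quadratic form in `(s (n+1), s n)` is multiplied by exactly `β²` at every step.
  have hE : ∀ n, s (n + 1) ^ 2 - τ * (s (n + 1) * s n) + β ^ 2 * s n ^ 2 ≤ (β ^ n * w) ^ 2 := by
    intro n
    induction n with
    | zero =>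
      have h1 := (abs_le.mp (hτ' (s 1) (s 0))).1
      have h2 : (β ^ 0 * w) ^ 2 = |s 1| ^ 2 + 2 * β * (|s 1| * |s 0|) + β ^ 2 * |s 0| ^ 2 := by ring
      rw [h2, sq_abs, sq_abs, zero_add]
      linarith
    | succ n ih =>
      rw [hs n]
      calc _ = β ^ 2 * (s (n + 1) ^ 2 - τ * (s (n + 1) * s n) + β ^ 2 * s n ^ 2) := by ring
        _ ≤ β ^ 2 * (β ^ n * w) ^ 2 := by gcongr
        _ = _ := by ring
  -- Because `|τ| ≤ 2β`, the form dominates `(|s (n+1)| - β |s n|)²`. This also covers a double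
  -- root, where only a rate above `β` is available.
  have hstep : ∀ n, |s (n + 1)| ≤ β * |s n| + β ^ n * w := by
    intro n
    have h1 := (abs_le.mp (hτ' (s (n + 1)) (s n))).2
    have h2 : (|s (n + 1)| - β * |s n|) ^ 2 ≤ (β ^ n * w) ^ 2 := by
      refine le_trans ?_ (hE n)
      have h3 : (|s (n + 1)| - β * |s n|) ^ 2 =
          |s (n + 1)| ^ 2 - 2 * β * (|s (n + 1)| * |s n|) + β ^ 2 * |s n| ^ 2 := by ring
      rw [h3, sq_abs, sq_abs]
      linarith
    have := (le_abs_self _).trans (abs_le_of_sq_le_sq h2 (by positivity))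
    linarith
  set D := |s 0| + w / (q - β) with hD
  have hDw : w ≤ (q - β) * D := by
    rw [hD, mul_add, mul_div_cancel₀ _ hqβ.ne']
    exact le_add_of_nonneg_left (by positivity)
  induction n with
  | zero => rw [pow_zero, one_mul, hD]; exact le_add_of_nonneg_right (by positivity)
  | succ n ih =>
    calc |s (n + 1)| ≤ β * (q ^ n * D) + q ^ n * ((q - β) * D) := by
          refine (hstep n).trans ?_
          gcongr
      _ = q ^ (n + 1) * D := by ring

/-- The product type carries the sup norm; the `L²` product supplies the triangle inequality for
`pairNorm`. -/
theorem pairNorm_eq_norm (p : E d × E d) : pairNorm p = ‖WithLp.toLp 2 p‖ := by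
  rw [WithLp.prod_norm_eq_of_L2]
  rfl

theorem pairNorm_add_le (p q : E d × E d) : pairNorm (p + q) ≤ pairNorm p + pairNorm q := by
  simp only [pairNorm_eq_norm, WithLp.toLp_add]
  exact norm_add_le _ _

variable {c : Fin m → E d → ℝ} {f : E d → ℝ} {xs : E d} {L μ : ℝ}

theorem rate_eq (hμ : 0 < μ) : rate (L / μ) = √L / (√L + √μ) := by
  have h : 0 < √μ := Real.sqrt_pos.mpr hμ
  have h2 : 0 ≤ √L := Real.sqrt_nonneg L
  rw [rate, Real.sqrt_div' L hμ.le]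
  field_simp
  ring

/-- The trace is affine in `a` and equals `2β` at `a = μ` and `-2β` at `a = L`; this is what the
choice of `Δt` and `γ` achieves. -/
theorem abs_trace_le (hμ : 0 < μ) (hμL : μ < L) {a : ℝ} (ha : μ ≤ a) (ha' : a ≤ L) :
    |1 + momentumParam L μ - stepSize L μ * a| ≤ 2 * ((√L - √μ) / (√L + √μ)) := by
  have h1 : 0 < √μ := Real.sqrt_pos.mpr hμ
  have h2 : √μ < √L := Real.sqrt_lt_sqrt hμ.le hμL
  have e1 : √μ ^ 2 = μ := Real.sq_sqrt hμ.le
  have e2 : √L ^ 2 = L := Real.sq_sqrt (hμ.trans hμL).le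
  have hs : 0 < √L + √μ := by positivity
  have hdt : 0 < stepSize L μ := by unfold stepSize; positivity
  have i1 := mul_le_mul_of_nonneg_left ha hdt.le
  have i2 := mul_le_mul_of_nonneg_left ha' hdt.le
  have j1 : stepSize L μ * μ = 1 + momentumParam L μ - 2 * ((√L - √μ) / (√L + √μ)) := by
    unfold stepSize momentumParam
    field_simp
    nlinarith
  have j2 : stepSize L μ * L = 1 + momentumParam L μ + 2 * ((√L - √μ) / (√L + √μ)) := by
    unfold stepSize momentumParam
    field_simp
    nlinarith
  rw [abs_le]
  constructor <;> linarith

theorem hess_mem (x v : E d) : hess c f x v ∈ tangent c x := proj_mem x _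

theorem linDisplacement_mem {dt γ : ℝ} {vs : Fin k → E d} (hv : ∀ i, vs i ∈ tangent c xs)
    {p : E d × E d} (h2 : p.2 ∈ tangent c xs) :
    linDisplacement c f dt γ xs vs p ∈ tangent c xs :=
  add_mem (neg_mem (Submodule.smul_mem _ _ (householder_mem hv (hess_mem _ _))))
    (Submodule.smul_mem _ _ h2)

theorem IsUnstableFrame.mem_tangent {hk : k ≤ d - m} {x : E d} {v : Fin k → E d}
    (hv : IsUnstableFrame c f hk x v) (i : Fin k) : v i ∈ tangent c x := by
  obtain ⟨b, l, hb, hvb⟩ := hv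
  exact hvb i ▸ hb.tangent _

theorem linIter_pow_mem {dt γ : ℝ} {vs : Fin k → E d} (hv : ∀ i, vs i ∈ tangent c xs)
    {p : E d × E d} (h1 : p.1 ∈ tangent c xs) (h2 : p.2 ∈ tangent c xs) (n : ℕ) :
    (((linIter c f dt γ xs vs) ^ n) p).1 ∈ tangent c xs ∧
      (((linIter c f dt γ xs vs) ^ n) p).2 ∈ tangent c xs := by
  induction n with
  | zero => exact ⟨h1, h2⟩
  | succ n ih =>
    rw [pow_succ', mul_apply_eq_comp, linIter_apply]
    have := linDisplacement_mem (c := c) (f := f) (dt := dt) (γ := γ) hv ih.2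
    exact ⟨add_mem ih.1 this, this⟩

theorem IsEigenbasis.exists_inner_householder_hess {b : Fin (d - m) → E d} {l : Fin (d - m) → ℝ}
    {x : E d} (hx : LinearIndependent ℝ (fun i => gradient (c i) x))
    (hb : IsEigenbasis c f x b l) (hk : k ≤ d - m) {v : Fin k → E d}
    (hv : ∀ i, v i = b (Fin.castLE hk i))
    (hl : ∀ i : Fin (d - m), ((i : ℕ) < k → -L ≤ l i ∧ l i ≤ -μ) ∧
      (k ≤ (i : ℕ) → μ ≤ l i ∧ l i ≤ L)) (i : Fin (d - m)) :
    ∃ a, μ ≤ a ∧ a ≤ L ∧ ∀ z ∈ MCSD.tangent c x,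
      inner ℝ (b i) (householder v (hess c f x z)) = a * inner ℝ (b i) z := by
  refine ⟨(if (i : ℕ) < k then (-1 : ℝ) else 1) * l i, ?_, ?_, fun z hz => ?_⟩
  · split_ifs with h
    · linarith [((hl i).1 h).2]
    · linarith [((hl i).2 (not_lt.mp h)).1]
  · split_ifs with h
    · linarith [((hl i).1 h).1]
    · linarith [((hl i).2 (not_lt.mp h)).2]
  · rw [hb.hess_eq hx hz, map_sum]
    simp only [map_smul, hb.householder_apply_basis hk hv, smul_smul]
    rw [hb.orthonormal.inner_right_fintype]
    ring

/-- Along each `b i`, both components of `A^n p` obey the same scalar recurrence (Cayley–Hamilton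
for the 2×2 block), so no Jordan form of `A` is needed. -/
theorem exists_isPowerBound (hk : k ≤ d - m) (hlicq : LICQ c) (hxs : xs ∈ feasible c)
    {δ : ℝ} (hδ : 0 < δ) (hμ : 0 < μ) (hμL : μ < L) (hsaddle : StrictSaddle c f k xs δ L μ)
    {vs : Fin k → E d} (hvs : IsUnstableFrame c f hk xs vs) :
    ∃ C0, IsPowerBound c xs (linIter c f (stepSize L μ) (momentumParam L μ) xs vs)
      (rate (L / μ)) C0 := by
  have hx := hlicq xs hxs
  have hvT := hvs.mem_tangent
  obtain ⟨b, l, hb, hvb⟩ := hvs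
  obtain ⟨b', l', hb', hl'⟩ := hsaddle xs hxs
    (by rw [geodesicDist_self hxs]; simpa using hδ)
  have hl := hb.bounds hx hb' hμ hl'
  set A := linIter c f (stepSize L μ) (momentumParam L μ) xs vs
  set β := (√L - √μ) / (√L + √μ)
  set q := rate (L / μ)
  have h1 : 0 < √μ := Real.sqrt_pos.mpr hμ
  have h2 : √μ < √L := Real.sqrt_lt_sqrt hμ.le hμL
  have hβ : 0 ≤ β := div_nonneg (by linarith) (by linarith)
  have hβq : β < q := by
    rw [show q = √L / (√L + √μ) from rate_eq hμ]
    exact div_lt_div_of_pos_right (by linarith) (by linarith)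
  have hqβ : 0 < q - β := sub_pos.mpr hβq
  have hq : 0 < q := hβ.trans_lt hβq
  set D := 1 + (‖A‖ + β) / (q - β)
  have hD : 0 ≤ D := by positivity
  refine ⟨1 + 2 * ((d - m : ℕ) * D), le_add_of_nonneg_right (by positivity),
    fun j _ p hp1 hp2 => ?_⟩
  set N := pairNorm p
  have hN : 0 ≤ N := pairNorm_nonneg p
  have hpN : ‖p‖ ≤ N := max_le (norm_fst_le_pairNorm p) (norm_snd_le_pairNorm p)
  have hA1 : ‖A p‖ ≤ ‖A‖ * N := (A.le_opNorm p).trans (by gcongr)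
  have hmem := fun n => linIter_pow_mem (f := f) (dt := stepSize L μ) (γ := momentumParam L μ)
    hvT hp1 hp2 n
  have hsucc : ∀ n, (A ^ (n + 1)) p = (((A ^ n) p).1 +
      linDisplacement c f (stepSize L μ) (momentumParam L μ) xs vs ((A ^ n) p),
      linDisplacement c f (stepSize L μ) (momentumParam L μ) xs vs ((A ^ n) p)) := fun n => by
    rw [pow_succ', mul_apply_eq_comp, ← linIter_apply]
  have scalar : ∀ s : ℕ → ℝ, ∀ a, μ ≤ a → a ≤ L → (∀ n, s (n + 2) =
      (1 + momentumParam L μ - stepSize L μ * a) * s (n + 1) - momentumParam L μ * s n) →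
      |s 0| ≤ N → |s 1| ≤ ‖A‖ * N → |s j| ≤ q ^ j * (D * N) := by
    intro s a ha ha' hs h0 h1
    refine (abs_le_of_recurrence hβ hβq (abs_trace_le hμ hμL ha ha') hs j).trans ?_
    have : D * N = N + (‖A‖ * N + β * N) / (q - β) := by ring
    rw [this]
    gcongr
  have hinner : ∀ i, ∀ z : E d, |inner ℝ (b i) z| ≤ ‖z‖ := fun i z =>
    (abs_real_inner_le_norm _ _).trans_eq (by rw [hb.orthonormal.1 i, one_mul])
  have hcomp : ∀ i, |inner ℝ (b i) ((A ^ j) p).1| ≤ q ^ j * (D * N) ∧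
      |inner ℝ (b i) ((A ^ j) p).2| ≤ q ^ j * (D * N) := by
    intro i
    obtain ⟨a, ha, ha', haz⟩ := hb.exists_inner_householder_hess hx hk hvb hl i
    have hrec : ∀ n, inner ℝ (b i)
        (linDisplacement c f (stepSize L μ) (momentumParam L μ) xs vs ((A ^ n) p)) =
        -(stepSize L μ * (a * inner ℝ (b i) ((A ^ n) p).1)) +
          momentumParam L μ * inner ℝ (b i) ((A ^ n) p).2 := fun n => by
      rw [linDisplacement, inner_add_right, inner_neg_right, real_inner_smul_right,
        real_inner_smul_right, haz _ (hmem n).1]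
    have r1 : ∀ n, inner ℝ (b i) ((A ^ (n + 1)) p).1 = inner ℝ (b i) ((A ^ n) p).1 +
        (-(stepSize L μ * (a * inner ℝ (b i) ((A ^ n) p).1)) +
          momentumParam L μ * inner ℝ (b i) ((A ^ n) p).2) := fun n => by
      rw [hsucc, inner_add_right, hrec]
    have r2 : ∀ n, inner ℝ (b i) ((A ^ (n + 1)) p).2 =
        -(stepSize L μ * (a * inner ℝ (b i) ((A ^ n) p).1)) +
          momentumParam L μ * inner ℝ (b i) ((A ^ n) p).2 := fun n => by
      rw [hsucc, hrec]
    refine ⟨scalar (fun n => inner ℝ (b i) ((A ^ n) p).1) a ha ha' (fun n => ?_) ?_ ?_,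
      scalar (fun n => inner ℝ (b i) ((A ^ n) p).2) a ha ha' (fun n => ?_) ?_ ?_⟩
    · have e1 := r1 (n + 1)
      have e2 := r2 n
      have e3 := r1 n
      rw [e1, e2, e3]
      ring
    · exact (hinner i _).trans ((norm_fst_le p).trans hpN)
    · simp only [pow_one]
      exact (hinner i _).trans ((norm_fst_le _).trans hA1)
    · have e1 := r2 (n + 1)
      have e2 := r2 n
      have e3 := r1 n
      rw [e1, e3, e2]
      ring
    · exact (hinner i _).trans ((norm_snd_le p).trans hpN)
    · simp only [pow_one]
      exact (hinner i _).trans ((norm_snd_le _).trans hA1)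
  have hnorm : ∀ z ∈ tangent c xs, (∀ i, |inner ℝ (b i) z| ≤ q ^ j * (D * N)) →
      ‖z‖ ≤ (d - m : ℕ) * (q ^ j * (D * N)) := by
    intro z hz h
    rw [← hb.sum_inner_smul hx hz]
    refine (norm_sum_le_of_le _ (n := fun _ => q ^ j * (D * N)) fun i _ => ?_).trans_eq (by simp)
    rw [norm_smul, hb.orthonormal.1 i, mul_one]
    exact h i
  refine (pairNorm_le_add _).trans ((add_le_add (hnorm _ (hmem j).1 fun i => (hcomp i).1)
    (hnorm _ (hmem j).2 fun i => (hcomp i).2)).trans ?_)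
  have : (0 : ℝ) ≤ q ^ j * N := by positivity
  linarith

/-- A perturbed linear iteration with a quadratic remainder decays at the rate of the powers of the
linear part. -/
theorem pairNorm_pow_le_of_quadratic {A : (E d × E d) →L[ℝ] (E d × E d)} {q C0 C Ch : ℝ}
    (hA : IsPowerBound c xs A q C0) (hq0 : 0 < q)
    (hAT : ∀ p : E d × E d, p.1 ∈ tangent c xs → p.2 ∈ tangent c xs →
      (A p).1 ∈ tangent c xs ∧ (A p).2 ∈ tangent c xs) (hC : 0 ≤ C)
    {p : ℕ → E d × E d} (hN : C * Ch ^ 2 * pairNorm (p 0) ≤ q * (1 - q)) (n : ℕ)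
    (hT : ∀ j ≤ n, (p j).1 ∈ tangent c xs ∧ (p j).2 ∈ tangent c xs)
    (hstep : ∀ j < n, pairNorm (p (j + 1) - A (p j)) ≤ C * pairNorm (p j) ^ 2)
    (hbound : ∀ j < n, pairNorm (p j) ≤ Ch * q ^ j * pairNorm (p 0)) (i : ℕ) :
    pairNorm ((A ^ i) (p n)) ≤ C0 * q ^ (i + n) * pairNorm (p 0) * (2 - q ^ n) := by
  have hpow : ∀ i, ∀ z : E d × E d, z.1 ∈ tangent c xs → z.2 ∈ tangent c xs →
      pairNorm ((A ^ i) z) ≤ C0 * q ^ i * pairNorm z := by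
    intro i z h1 h2
    -- The power bound is assumed only from the first power on; `1 ≤ C0` covers the zeroth.
    rcases Nat.eq_zero_or_pos i with rfl | hi
    · simp only [pow_zero, one_apply_eq_self, mul_one]
      exact le_mul_of_one_le_left (pairNorm_nonneg z) hA.1
    · exact hA.2 i hi z h1 h2
  have hC0 : 0 ≤ C0 := zero_le_one.trans hA.1
  have hN0 := pairNorm_nonneg (p 0)
  -- Carrying all `A^i` replaces the variation-of-constants sum. A step adds `q^n (1 - q)` to the
  -- factor `2 - q^n`, giving `2 - q^(n+1)`.
  induction n generalizing i with
  | zero =>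
    have := hpow i (p 0) (hT 0 le_rfl).1 (hT 0 le_rfl).2
    simp only [add_zero, pow_zero]
    linarith
  | succ n ih =>
    have ih' := ih (fun j hj => hT j (hj.trans n.le_succ)) (fun j hj => hstep j (hj.trans n.lt_succ_self))
      (fun j hj => hbound j (hj.trans n.lt_succ_self)) (i + 1)
    set e := p (n + 1) - A (p n) with he
    have hTn := hT n n.le_succ
    have hTe : e.1 ∈ tangent c xs ∧ e.2 ∈ tangent c xs :=
      ⟨sub_mem (hT (n + 1) le_rfl).1 (hAT _ hTn.1 hTn.2).1,
        sub_mem (hT (n + 1) le_rfl).2 (hAT _ hTn.1 hTn.2).2⟩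
    have hdecomp : (A ^ i) (p (n + 1)) = (A ^ (i + 1)) (p n) + (A ^ i) e := by
      rw [pow_succ, mul_apply_eq_comp, ← map_add, he, add_sub_cancel]
    have h1 : pairNorm e ≤ q ^ (2 * n) * (q * (1 - q)) * pairNorm (p 0) := by
      calc pairNorm e ≤ C * pairNorm (p n) ^ 2 := hstep n n.lt_succ_self
        _ ≤ C * (Ch * q ^ n * pairNorm (p 0)) ^ 2 := by
            have := pairNorm_nonneg (p n)
            gcongr
            exact hbound n n.lt_succ_self
        _ = q ^ (2 * n) * (C * Ch ^ 2 * pairNorm (p 0)) * pairNorm (p 0) := by ring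
        _ ≤ _ := by gcongr
    rw [hdecomp]
    calc _ ≤ C0 * q ^ (i + 1 + n) * pairNorm (p 0) * (2 - q ^ n) +
          C0 * q ^ i * (q ^ (2 * n) * (q * (1 - q)) * pairNorm (p 0)) := by
          refine (pairNorm_add_le _ _).trans (add_le_add ih' ((hpow i e hTe.1 hTe.2).trans ?_))
          gcongr
      _ = _ := by ring

theorem IsCoord.norm_sub_le (hc : ∀ i, ContDiff ℝ ∞ (c i)) {r : ℝ} {x w : E d} {p : E d × E d}
    (h : IsCoord c xs r x w p) : ‖x - xs‖ ≤ ‖p.1‖ := by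
  obtain ⟨-, -, -, g, V, hg, rfl, hgu, rfl, -⟩ := h
  rw [← hgu]
  exact hg.norm_sub_le hc (right_mem_Icc.mpr zero_le_one)

/-- The first `n` steps of a run stay in the domain of the coordinates, and the coordinates decay
geometrically. -/
theorem partialRun_bound {hk : k ≤ d - m} {dt γ q C0 C Ch r r1 δ rs : ℝ}
    {A : (E d × E d) →L[ℝ] (E d × E d)}
    (hA : IsPowerBound c xs A q C0) (hq0 : 0 < q) (hq1 : q < 1)
    (hAT : ∀ p : E d × E d, p.1 ∈ tangent c xs → p.2 ∈ tangent c xs →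
      (A p).1 ∈ tangent c xs ∧ (A p).2 ∈ tangent c xs) (hC : 0 ≤ C) (hrs : 0 < rs)
    (hW : CoordsWellDefined c xs r r1 δ) (hS : StepExpansion c f hk dt γ xs A r C rs)
    (hCh : 2 * C0 < Ch) {x0 : E d} {p₀ : E d × E d} (h0 : IsCoord c xs r x0 0 p₀)
    (hN : C * Ch ^ 2 * pairNorm p₀ ≤ q * (1 - q)) (hN' : Ch * pairNorm p₀ ≤ rs)
    {x w : ℕ → E d} {v : ℕ → Fin k → E d} (hx0 : x 0 = x0) (hw0 : w 0 = 0) (n : ℕ)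
    (hstep : ∀ j < n, IsStep c f hk dt γ (x j) (w j) (v j) (x (j + 1)) (w (j + 1))) :
    ∃ p : ℕ → E d × E d, p 0 = p₀ ∧ ∀ j ≤ n, IsCoord c xs r (x j) (w j) (p j) ∧
      pairNorm (p j) < rs ∧ pairNorm (p j) ≤ Ch * q ^ j * pairNorm p₀ := by
  have hN0 := pairNorm_nonneg p₀
  have hC0 : 1 ≤ C0 := hA.1
  have hChN : 0 ≤ Ch := by linarith
  have hex0 : ∃ p, IsCoord c xs r (x 0) (w 0) p := ⟨p₀, by rwa [hx0, hw0]⟩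
  set p : ℕ → E d × E d := fun j => Classical.epsilon (IsCoord c xs r (x j) (w j))
  have hspec : ∀ j, (∃ p, IsCoord c xs r (x j) (w j) p) → IsCoord c xs r (x j) (w j) (p j) :=
    fun j h => Classical.epsilon_spec h
  have hp0 : p 0 = p₀ := hW.coords_unique _ _ _ _ (hspec 0 hex0) (by rwa [hx0, hw0])
  refine ⟨p, hp0, fun j hj => ?_⟩
  induction j using Nat.strong_induction_on with
  | _ j ih =>
    have hcoord : IsCoord c xs r (x j) (w j) (p j) := by
      rcases j with _ | j
      · exact hspec 0 hex0
      · obtain ⟨h1, h2, -⟩ := ih j j.lt_succ_self (by omega)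
        obtain ⟨p', hp', -⟩ := hS.expansion _ _ _ h1 h2 _ _ _ (hstep j (by omega))
        exact hspec _ ⟨p', hp'⟩
    have hcoord' : ∀ i ≤ j, IsCoord c xs r (x i) (w i) (p i) := fun i hi => by
      rcases hi.lt_or_eq with h | rfl
      · exact (ih i h (by omega)).1
      · exact hcoord
    have hquad := pairNorm_pow_le_of_quadratic (p := p) (Ch := Ch) hA hq0 hAT hC (by rwa [hp0]) j
      (fun i hi => ⟨(hcoord' i hi).1, (hcoord' i hi).2.1⟩) (fun i hi => ?_)
      (fun i hi => by rw [hp0]; exact (ih i hi (by omega)).2.2) 0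
    · simp only [pow_zero, one_apply_eq_self, zero_add] at hquad
      rw [hp0] at hquad
      have hqj : 0 < q ^ j := pow_pos hq0 j
      have hqj1 : q ^ j ≤ 1 := pow_le_one₀ hq0.le hq1.le
      have h1 : pairNorm (p j) ≤ 2 * C0 * (q ^ j * pairNorm p₀) := by
        refine hquad.trans ?_
        have : 0 ≤ C0 * q ^ j * pairNorm p₀ * q ^ j := by positivity
        linarith
      refine ⟨hcoord, ?_, h1.trans ?_⟩
      -- Strictness comes from `2 * C0 < Ch` and is lost when the initial norm is zero; there `0 <
      -- rs` is used.
      · rcases hN0.eq_or_lt with h | h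
        · rw [← h, mul_zero, mul_zero] at h1
          exact h1.trans_lt hrs
        · calc pairNorm (p j) ≤ 2 * C0 * (q ^ j * pairNorm p₀) := h1
            _ ≤ 2 * C0 * (1 * pairNorm p₀) := by gcongr
            _ < Ch * pairNorm p₀ := by rw [one_mul]; gcongr
            _ ≤ rs := hN'
      · rw [mul_assoc Ch]
        exact mul_le_mul_of_nonneg_right hCh.le (mul_nonneg hqj.le hN0)
    · obtain ⟨h1, h2, -⟩ := ih i hi (by omega)
      obtain ⟨p', hp', herr⟩ := hS.expansion _ _ _ h1 h2 _ _ _ (hstep i (by omega))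
      rwa [← hW.coords_unique _ _ _ _ hp' (hcoord' (i + 1) (by omega))]

/-- Iterating a partially defined choice of steps. -/
theorem exists_isRun {hk : k ≤ d - m} {dt γ : ℝ} (x0 : E d)
    (h : ∀ (x w : ℕ → E d) (v : ℕ → Fin k → E d), x 0 = x0 → w 0 = 0 → ∀ n,
      (∀ j < n, IsStep c f hk dt γ (x j) (w j) (v j) (x (j + 1)) (w (j + 1))) →
      ∃ v' x' w', IsStep c f hk dt γ (x n) (w n) v' x' w') :
    ∃ x w v, IsRun c f hk dt γ x0 x w v := by
  -- The choice is arbitrary where no step exists; the strong induction shows that such states are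
  -- never reached.
  set nxt : E d × E d → (Fin k → E d) × E d × E d := fun s =>
    Classical.epsilon fun t => IsStep c f hk dt γ s.1 s.2 t.1 t.2.1 t.2.2
  set s : ℕ → E d × E d := fun n => Nat.rec (x0, 0) (fun _ s => (nxt s).2) n
  have hs : ∀ n, IsStep c f hk dt γ (s n).1 (s n).2 (nxt (s n)).1 (s (n + 1)).1 (s (n + 1)).2 := by
    intro n
    induction n using Nat.strong_induction_on with
    | _ n ih =>
      obtain ⟨v', x', w', hstep⟩ := h (fun n => (s n).1) (fun n => (s n).2)
        (fun n => (nxt (s n)).1) rfl rfl n ih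
      exact Classical.epsilon_spec
        (p := fun t : (Fin k →
            E d) × E d × E d => IsStep c f hk dt γ (s n).1 (s n).2 t.1 t.2.1 t.2.2)
        ⟨(v', x', w'), hstep⟩
  exact ⟨fun n => (s n).1, fun n => (s n).2, fun n => (nxt (s n)).1, rfl, rfl, hs⟩

end Convergence

end MCSD

/-! ### The main theorem. -/

theorem mainTheorem4 {d m k : ℕ} (hk : k ≤ d - m)
    (c : Fin m → MCSD.E d → ℝ) (hc : ∀ i, ContDiff ℝ ∞ (c i)) (hlicq : MCSD.LICQ c)
    (f : MCSD.E d → ℝ) (hf : ContDiff ℝ ∞ f)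
    (xs : MCSD.E d) (hxs : xs ∈ MCSD.feasible c) (hcrit : MCSD.rgrad c f xs = 0)
    (δ L μ : ℝ) (hδ : 0 < δ) (hμ : 0 < μ) (hμL : μ < L)
    (hsaddle : MCSD.StrictSaddle c f k xs δ L μ)
    (vs : Fin k → MCSD.E d) (hvs : MCSD.IsUnstableFrame c f hk xs vs)
    (κ : ℝ) (hκ : κ = L / μ)
    (dt γ : ℝ) (hdt : dt = MCSD.stepSize L μ) (hγ : γ = MCSD.momentumParam L μ)
    (A : (MCSD.E d × MCSD.E d) →L[ℝ] (MCSD.E d × MCSD.E d))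
    (hA : A = MCSD.linIter c f dt γ xs vs) :
    (∃ C0, MCSD.IsPowerBound c xs A (MCSD.rate κ) C0) ∧
    ∃ r r1 C rs : ℝ, 0 < r ∧ 0 < r1 ∧ 0 < C ∧ 0 < rs ∧ rs ≤ r ∧
      MCSD.CoordsWellDefined c xs r r1 δ ∧
      MCSD.StepExpansion c f hk dt γ xs A r C rs ∧
      ∀ C0, MCSD.IsPowerBound c xs A (MCSD.rate κ) C0 → ∀ Ch, 2 * C0 < Ch →
        ∀ x0 ζ0 : MCSD.E d, MCSD.IsCoord c xs r x0 0 (ζ0, 0) →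
          ‖ζ0‖ ≤ min (√κ / ((1 + √κ) ^ 2 * C * Ch ^ 2)) (rs / Ch) →
          (∃ x w v, MCSD.IsRun c f hk dt γ x0 x w v) ∧
          ∀ x w v, MCSD.IsRun c f hk dt γ x0 x w v →
            Tendsto x atTop (𝓝 xs) ∧
            ∃ ζ ρ : ℕ → MCSD.E d, (∀ n, MCSD.IsCoord c xs r (x n) (w n) (ζ n, ρ n)) ∧
              ζ 0 = ζ0 ∧ ρ 0 = 0 ∧
              ∀ n, ‖ζ n‖ ≤ MCSD.pairNorm (ζ n, ρ n) ∧
                MCSD.pairNorm (ζ n, ρ n) ≤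
                  Ch * MCSD.rate κ ^ n * MCSD.pairNorm (ζ 0, ρ 0) := by
  refine ⟨by rw [hA, hκ, hdt, hγ]
             exact MCSD.exists_isPowerBound hk hlicq hxs hδ hμ hμL hsaddle hvs, ?_⟩
  have hx := hlicq xs hxs
  obtain ⟨ra, hra, hcoords⟩ := MCSD.exists_coordsWellDefined hc hxs hx
  obtain ⟨rb, hrb, hexp⟩ :=
      MCSD.exists_stepExpansion hk hc hlicq hf hxs hcrit hδ hμ hsaddle hvs dt γ
  set r := min (min ra rb) δ
  have hr : 0 < r := lt_min (lt_min hra hrb) hδ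
  obtain ⟨r1, hr1, hW⟩ :=
    hcoords r hr ((min_le_left _ _).trans (min_le_left _ _)) δ (min_le_right _ _)
  obtain ⟨C, rs, hC, hrs, hrsr, hS⟩ :=
    hexp r hr ((min_le_left _ _).trans (min_le_right _ _))
  rw [← hA] at hS
  refine ⟨r, r1, C, rs, hr, hr1, hC, hrs, hrsr, hW, hS, fun C0 hC0 Ch hCh x0 ζ0 h0 hζ => ?_⟩
  have hκ0 : 0 < √κ := by
    rw [hκ]; exact Real.sqrt_pos.mpr (div_pos (hμ.trans hμL) hμ)
  have hCh0 : 0 < Ch := by linarith [hC0.1]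
  set q := MCSD.rate κ with hq
  have hqeq : q = √κ / (1 + √κ) := by
    rw [hq, MCSD.rate]; field_simp; ring
  have hq0 : 0 < q := by rw [hqeq]; positivity
  have hq1 : q < 1 := by rw [hqeq, div_lt_one (by positivity)]; linarith
  have hnorm0 : MCSD.pairNorm (ζ0, (0 : MCSD.E d)) = ‖ζ0‖ := by
    simp [MCSD.pairNorm]
  have hN : C * Ch ^ 2 * MCSD.pairNorm (ζ0, (0 : MCSD.E d)) ≤ q * (1 - q) := by
    rw [hnorm0]
    have h1 := hζ.trans (min_le_left _ _)
    -- The admissible radius is calibrated so that `√κ / (1 + √κ)² = q (1 - q)`, the budget of the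
    -- geometric series.
    calc C * Ch ^ 2 * ‖ζ0‖ ≤ C * Ch ^ 2 * (√κ / ((1 + √κ) ^ 2 * C * Ch ^ 2)) := by gcongr
      _ = q * (1 - q) := by rw [hqeq]; field_simp; ring
  have hN' : Ch * MCSD.pairNorm (ζ0, (0 : MCSD.E d)) ≤ rs := by
    rw [hnorm0]
    have h1 := hζ.trans (min_le_right _ _)
    rwa [le_div_iff₀' hCh0] at h1
  have hAT : ∀ p : MCSD.E d × MCSD.E d, p.1 ∈ MCSD.tangent c xs → p.2 ∈ MCSD.tangent c xs →
      (A p).1 ∈ MCSD.tangent c xs ∧ (A p).2 ∈ MCSD.tangent c xs := by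
    intro p h1 h2
    have := MCSD.linIter_pow_mem (f := f) (dt := dt) (γ := γ) hvs.mem_tangent h1 h2 1
    rwa [← hA, pow_one] at this
  have hpartial := fun (x w : ℕ → MCSD.E d) (v : ℕ → Fin k → MCSD.E d) (hx0 : x 0 = x0)
      (hw0 : w 0 = 0) (n : ℕ) => MCSD.partialRun_bound (v :=
          v) hC0 hq0 hq1 hAT hC.le hrs hW hS hCh h0
    hN hN' hx0 hw0 n
  refine ⟨MCSD.exists_isRun x0 fun x w v hx0 hw0 n hn => ?_, fun x w v hrun => ?_⟩
  · obtain ⟨p, -, hp⟩ := hpartial x w v hx0 hw0 n hn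
    exact hS.exists_step _ _ _ (hp n le_rfl).1 (hp n le_rfl).2.1
  · have hall : ∀ n, ∃ p, MCSD.IsCoord c xs r (x n) (w n) p ∧
        MCSD.pairNorm p ≤ Ch * q ^ n * MCSD.pairNorm (ζ0, (0 : MCSD.E d)) := fun n => by
      obtain ⟨p, -, hp⟩ := hpartial x w v hrun.start hrun.momentum n fun j _ => hrun.step j
      exact ⟨p n, (hp n le_rfl).1, (hp n le_rfl).2.2⟩
    choose p hp hpb using hall
    have hp0 : p 0 = (ζ0, 0) :=
      hW.coords_unique _ _ _ _ (hp 0) (by rwa [hrun.start, hrun.momentum])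
    refine ⟨?_, fun n => (p n).1, fun n => (p n).2, hp, congrArg Prod.fst hp0,
        congrArg Prod.snd hp0,
      fun n => ⟨MCSD.norm_fst_le_pairNorm _, by simpa only [hp0] using hpb n⟩⟩
    rw [tendsto_iff_norm_sub_tendsto_zero]
    refine squeeze_zero (fun n => norm_nonneg _) (fun n => ((hp n).norm_sub_le hc).trans
      ((MCSD.norm_fst_le_pairNorm _).trans (hpb n))) ?_
    simpa using ((tendsto_pow_atTop_nhds_zero_of_lt_one hq0.le hq1).const_mul Ch).mul_const
      (MCSD.pairNorm (ζ0, (0 : MCSD.E d)))
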